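/- **Setting.** Let $\mathbb{T}^1=\mathbb{R}/\mathbb{Z}$. A *modulus of continuity* is a strictly increasing continuous function $\varpi$ on $(0,\infty)$ such that $\varpi(x+y)\le\varpi(x)+\varpi(y)$, $\varpi(px)\le p\,\varpi(x)$ and $\varpi(ax)\le(\lfloor a\rfloor+1)\varpi(x)$ for all real $x,y,a>0$ and integers $p\ge1$. Let $\varpi$ be a modulus of continuity, and let $T$ be a $C_{2,\varpi}$ orientation-preserving diffeomorphism of $\mathbb{T}^1$: it has a lift $F:\mathbb{R}\to\mathbb{R}$ with $F(x+1)=F(x)+1$ that is of class $C^2$ with $F'>0$ and satisfies $|F''(x)-F''(y)|\le\varpi(|x-y|)$ for all $x\ne y$ in $[0,1)$. Assume that the rotation number $\rho\in[0,1)$ of $T$ (the fractional part of $\lim_n F^n(x)/n$) is irrational, and let $\rho=[k_1,k_2,\dots]$ be its continued fraction expansion. Put $$\lambda=\frac{1}{\sqrt{1+e^{-\mathcal C}}}\in\Big(\tfrac12,1\Big),\qquad \mathcal C=\int_0^1\Big|\frac{d}{dx}\log F'(x)\Big|\,dx .$$ We say that $T$ *admits a $C^1$ conjugacy* if there is a homeomorphism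 $\phi$ of $\mathbb{T}^1$ with $\phi\circ T\circ\phi^{-1}=R_\rho$, where $R_\rho(\theta)=\theta+\rho \bmod 1$, and every such $\phi$ is an orientation-preserving $C^1$ diffeomorphism (that is, it has a $C^1$ lift with positive derivative). All $\mathcal O$ in $n$ are as $n\to\infty$; $f\sim g$ means that $f$ and $g$ are bounded by constant multiples of each other as $x\to0^+$. Write $L_i(x)$ for the $i$-fold iterated logarithm of $x^{-1}$ ($L_1(x)=\log x^{-1}$, $L_{i+1}=\log L_i$). **Corollary 4.4.** $T$ admits a $C^1$ conjugacy in each of the following cases. (C1) (Constant type.) $k_{n+1}=\mathcal O(1)$ and $\displaystyle\int_0^1\frac{\varpi(y)}{y}\,dy<\infty$. The integral is finite, for instance, if $\varpi\sim x$; if $\varpi\sim x^\alpha$ with $0<\alpha<1$; if $\varpi\sim(\log x^{-1})^{-\alpha}$ with $\alpha>1$; or if $\varpi\sim 1/\big(L_1\cdots L_{\ell-1}\,L_\ell^{1+\sigma}\big)$ with an integer $\ell\ge1$ and $\sigma>0$. (C2) (Polynomial type.) For some $\nu>0$, $k_{n+1}=\mathcal O(n^\nu)$ and $\displaystyle\int_0^1\frac{(-\log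 y)^\nu\varpi(y)}{y}\,dy<\infty$. The integral is finite, for instance, if $\varpi\sim x$; if $\varpi\sim x^\alpha$ with $0<\alpha<1$; if $\varpi\sim(\log x^{-1})^{-\alpha}$ with $\alpha>\nu+1$; or if $\varpi\sim 1/\big(L_1^{\nu}\cdot L_1\cdots L_{\ell-1}\,L_\ell^{1+\sigma}\big)$ with an integer $\ell\ge1$ and $\sigma>0$. (C3) (Exponential type.) For some $1<a<\lambda^{-1}$, $k_{n+1}=\mathcal O(a^n)$ and $\displaystyle\int_0^1\frac{\varpi(y)}{y^{1+b}}\,dy<\infty$, where $b=\log a/\log(\lambda^{-1})\in(0,1)$, that is, $a=\lambda^{-b}$. The integral is finite, for instance, if $\varpi\sim x$, or if $\varpi\sim x^\alpha$ with $b<\alpha<1$. -/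

import Mathlib

open Set Filter Topology MeasureTheory Asymptotics

noncomputable section

namespace CircleConj

/-- A modulus of continuity on the open half-line `(0, ∞)`. -/
structure IsModulus (ϖ : ℝ → ℝ) : Prop where
  strictMono : StrictMonoOn ϖ (Ioi 0)
  continuous : ContinuousOn ϖ (Ioi 0)
  subadd : ∀ x y : ℝ, 0 < x → 0 < y → ϖ (x + y) ≤ ϖ x + ϖ y
  nat_mul : ∀ (p : ℕ) (x : ℝ), 1 ≤ p → 0 < x → ϖ (p * x) ≤ p * ϖ x
  real_mul : ∀ a x : ℝ, 0 < a → 0 < x → ϖ (a * x) ≤ ((⌊a⌋ : ℝ) + 1) * ϖ x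

/-- `F : ℝ → ℝ` (monotone, with `F (x + 1) = F x + 1`) is a lift of the self-map `f` of `ℝ / ℤ`. -/
def IsLift (F : CircleDeg1Lift) (f : UnitAddCircle → UnitAddCircle) : Prop :=
  ∀ x : ℝ, f (x : UnitAddCircle) = ((F x : ℝ) : UnitAddCircle)

/-- `F` is the lift of an orientation-preserving circle diffeomorphism of class `C_{2,ϖ}`: it is
of class `C²`, its derivative is positive, and its second derivative, on the fundamental domain
`[0, 1)` of the circle, has the modulus of continuity `ϖ`. -/
structure IsC2ModulusDiffeoLift (ϖ : ℝ → ℝ) (F : CircleDeg1Lift) : Prop where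
  contDiff : ContDiff ℝ 2 (F : ℝ → ℝ)
  deriv_pos : ∀ x : ℝ, 0 < deriv (F : ℝ → ℝ) x
  modulus : ∀ x ∈ Ico (0 : ℝ) 1, ∀ y ∈ Ico (0 : ℝ) 1, x ≠ y →
    |iteratedDeriv 2 (F : ℝ → ℝ) x - iteratedDeriv 2 (F : ℝ → ℝ) y| ≤ ϖ |x - y|

/-- The circle homeomorphism `f` is an orientation-preserving `C¹` diffeomorphism
(by the inverse function theorem, positivity of the derivative makes the inverse `C¹` too). -/
def IsC1CircleDiffeo (f : UnitAddCircle ≃ₜ UnitAddCircle) : Prop :=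
  ∃ F : CircleDeg1Lift, IsLift F f ∧ ContDiff ℝ 1 (F : ℝ → ℝ) ∧
    ∀ x : ℝ, 0 < deriv (F : ℝ → ℝ) x

/-- The rotation number, in `[0, 1)`, of the circle homeomorphism with lift `F`. -/
def rotationNumber (F : CircleDeg1Lift) : ℝ :=
  Int.fract (CircleDeg1Lift.translationNumber F)

/-- `φ ∘ T ∘ φ⁻¹` is the rotation of `ℝ / ℤ` by `ρ`. -/
def ConjugatesToRotation (φ T : UnitAddCircle ≃ₜ UnitAddCircle) (ρ : ℝ) : Prop :=
  ∀ θ : UnitAddCircle, φ (T (φ.symm θ)) = θ + (ρ : UnitAddCircle)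

/-- The conjugacy of `T` with the rotation by `ρ` exists and is `C¹`: some homeomorphism conjugates
`T` to the rotation, and every such homeomorphism is an orientation-preserving
`C¹` diffeomorphism. -/
def AdmitsC1Conjugacy (T : UnitAddCircle ≃ₜ UnitAddCircle) (ρ : ℝ) : Prop :=
  (∃ φ : UnitAddCircle ≃ₜ UnitAddCircle, ConjugatesToRotation φ T ρ) ∧
    ∀ φ : UnitAddCircle ≃ₜ UnitAddCircle, ConjugatesToRotation φ T ρ → IsC1CircleDiffeo φ

/-- The partial quotient `k_{n+1}` of `ρ = [k_1, k_2, …] ∈ (0, 1)`. The default value `0` is taken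
only if the continued fraction has terminated, which never happens for irrational `ρ`. -/
def partialQuotientSucc (ρ : ℝ) (n : ℕ) : ℝ :=
  ((GenContFract.of ρ).partDens.get? n).getD 0

/-- The constant `λ = 1 / √(1 + e^{-𝒞})`, where `𝒞` is the integral over the circle of
`|(log T')'|` and `F` is the lift of `T`. -/
def denjoyLambda (F : CircleDeg1Lift) : ℝ :=
  1 / √(1 + Real.exp
    (-∫ x in (0 : ℝ)..1, |deriv (fun t : ℝ => Real.log (deriv (F : ℝ → ℝ) t)) x|))

/-- `ϖ ∼ x`, up to constant factors, as `x → 0⁺`. -/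
def IsLipschitzType (ϖ : ℝ → ℝ) : Prop :=
  ϖ =Θ[𝓝[>] (0 : ℝ)] fun x => x

/-- `ϖ ∼ x ^ α`, up to constant factors, as `x → 0⁺`. -/
def IsHolderType (α : ℝ) (ϖ : ℝ → ℝ) : Prop :=
  ϖ =Θ[𝓝[>] (0 : ℝ)] fun x => x ^ α

/-- `ϖ ∼ (log x⁻¹) ^ (-α)`, up to constant factors, as `x → 0⁺`. -/
def IsLogHolderType (α : ℝ) (ϖ : ℝ → ℝ) : Prop :=
  ϖ =Θ[𝓝[>] (0 : ℝ)] fun x => (Real.log x⁻¹) ^ (-α)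

/-- `ϖ ∼ 1 / ((log x⁻¹) ^ ν * L₁ x * ⋯ * L_{ℓ-1} x * (L_ℓ x) ^ (1 + σ))`, up to constant factors,
as `x → 0⁺`, where `L_i x` is the `i`-fold iterated logarithm of `x⁻¹`. -/
def IsIterLogType (ν : ℝ) (ℓ : ℕ) (σ : ℝ) (ϖ : ℝ → ℝ) : Prop :=
  ϖ =Θ[𝓝[>] (0 : ℝ)] fun x => 1 / ((Real.log x⁻¹) ^ ν *
    (∏ i ∈ Finset.Ico 1 ℓ, Real.log^[i] x⁻¹) * (Real.log^[ℓ] x⁻¹) ^ (1 + σ))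

end CircleConj

end

/-! Let `ret F m` be the lift F^q − p, with p/q the convergents of the translation number, indexed
so that level 0 is the translation by −1. The crux is `exists_abs_retLog_le`: |log (ret F (m+1))'|
is at most a constant times y_m, where y is the sequence ϖ(λ^k) convolved twice with the geometric
sequence λ^k.

Two ingredients feed it. The Denjoy–Koksma inequality bounds |log (ret F m)'| by 𝒞
(`abs_logDeriv_den_le`); comparing nested return intervals then makes their lengths shrink by λ²
every two levels (`retLen_add_two_le`). On the other side, the C_{2,ϖ} condition says that over an
interval of length h the log slope of F equals the mean of log F' at the endpoints up to O(h ϖ(h))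
(`exists_trapezoid`). The images of a return interval of level m under the first q_{m+1} iterates
have total length at most 3, so `ret F (m+1)` obeys the same rule with error O(ϖ(λ^m))
(`exists_ret_trapezoid`). A slope over an interval is a weighted mean of the slopes over its two
parts; this yields a recursion with factor λ for the increments of log (ret F (m+1))', hence the
first convolution. Commutation of consecutive return maps yields a second recursion, for the log
slopes, hence the second convolution.

Suppose that the sum of k_{m+1} y_m is finite. Writing an arbitrary iterate as a product of return
maps bounds the derivatives of all iterates (`abs_logDeriv_le_tsum`). The return lengths divided by
those of the rotation then converge uniformly to a positive u with u ∘ F = F' u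
(`exists_invariant_density`). The normalised primitive of 1/u is a C¹ conjugacy, and any other
conjugacy differs from it by a rotation.

Finally, weights A with A(i+j) ≤ A(i) W(j) and summable W(i) λ^i pass through both convolutions
(`summable_mul_geomConv`), which leaves the series of A(k) ϖ(λ^k). This series is controlled by the
integral, cut at the points λ^k. Constant type is the polynomial type with ν = 0. -/

namespace CircleConj

/-! ### Continued fractions -/

section ContFrac

/-- The orbit of `fract τ` under the Gauss map. -/
noncomputable def gaussOrbit (τ : ℝ) : ℕ → ℝ
  | 0 => Int.fract τ
  | n + 1 => Int.fract (gaussOrbit τ n)⁻¹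

/-- The partial quotients of `τ`. -/
noncomputable def quot (τ : ℝ) (n : ℕ) : ℕ := ⌊(gaussOrbit τ n)⁻¹⌋₊

/-- The denominators of the convergents of `τ`, starting with `0, 1`. -/
noncomputable def den (τ : ℝ) : ℕ → ℕ
  | 0 => 0
  | 1 => 1
  | n + 2 => quot τ n * den τ (n + 1) + den τ n

/-- The numerators of the convergents of `τ`, starting with `1, ⌊τ⌋`. -/
noncomputable def num (τ : ℝ) : ℕ → ℤ
  | 0 => 1
  | 1 => ⌊τ⌋
  | n + 2 => quot τ n * num τ (n + 1) + num τ n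

/-- The signed approximation error of the convergents of `τ`. -/
noncomputable def err (τ : ℝ) (n : ℕ) : ℝ := den τ n * τ - num τ n

variable {τ : ℝ}

lemma irrational_gaussOrbit (h : Irrational τ) (n : ℕ) : Irrational (gaussOrbit τ n) := by
  induction n with
  | zero => exact irrational_sub_intCast_iff.2 h
  | succ n ih => exact irrational_sub_intCast_iff.2 (irrational_inv_iff.2 ih)

lemma gaussOrbit_pos (h : Irrational τ) (n : ℕ) : 0 < gaussOrbit τ n := by
  have h0 : 0 ≤ gaussOrbit τ n := by
    cases n <;> exact Int.fract_nonneg _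
  exact lt_of_le_of_ne h0 (irrational_gaussOrbit h n).ne_zero.symm

lemma gaussOrbit_lt_one (n : ℕ) : gaussOrbit τ n < 1 := by
  cases n <;> exact Int.fract_lt_one _

lemma one_le_quot (h : Irrational τ) (n : ℕ) : 1 ≤ quot τ n := by
  apply Nat.le_floor
  simpa using (one_le_inv₀ (gaussOrbit_pos h n)).2 (gaussOrbit_lt_one n).le

lemma inv_gaussOrbit (h : Irrational τ) (n : ℕ) :
    (gaussOrbit τ n)⁻¹ = quot τ n + gaussOrbit τ (n + 1) := by
  have h0 := inv_pos.2 (gaussOrbit_pos h n)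
  have : (quot τ n : ℝ) = (⌊(gaussOrbit τ n)⁻¹⌋ : ℝ) := by
    rw [quot, natCast_floor_eq_intCast_floor h0.le]
  rw [this, gaussOrbit, Int.floor_add_fract]

lemma err_zero : err τ 0 = -1 := by simp [err, den, num]

lemma err_add_two (n : ℕ) : err τ (n + 2) = quot τ n * err τ (n + 1) + err τ n := by
  simp only [err, den, num]; push_cast; ring

/-- The Gauss map identity `inv_gaussOrbit` collapses the three-term recursion of the errors into a
two-term one. Alternating signs and decreasing sizes are read off from it. -/
lemma err_succ (h : Irrational τ) (n : ℕ) : err τ (n + 1) = -(gaussOrbit τ n) * err τ n := by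
  induction n with
  | zero =>
    rw [err_zero, gaussOrbit, ← Int.self_sub_floor]
    simp [err, den, num]
  | succ n ih =>
    have h0 := (gaussOrbit_pos h n).ne'
    have h1 := inv_gaussOrbit h n
    have h2 : err τ n = -(quot τ n + gaussOrbit τ (n + 1)) * err τ (n + 1) := by
      rw [← h1, ih]; field_simp
    rw [err_add_two, h2]; ring

lemma err_ne_zero (h : Irrational τ) (n : ℕ) : err τ n ≠ 0 := by
  induction n with
  | zero => simp [err_zero]
  | succ n ih =>
    rw [err_succ h]
    exact mul_ne_zero (neg_ne_zero.2 (gaussOrbit_pos h n).ne') ih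

lemma abs_err_pos (h : Irrational τ) (n : ℕ) : 0 < |err τ n| := abs_pos.2 (err_ne_zero h n)

lemma abs_err_succ (h : Irrational τ) (n : ℕ) :
    |err τ (n + 1)| = gaussOrbit τ n * |err τ n| := by
  rw [err_succ h, abs_mul, abs_neg, abs_of_pos (gaussOrbit_pos h n)]

lemma abs_err_succ_lt (h : Irrational τ) (n : ℕ) : |err τ (n + 1)| < |err τ n| := by
  rw [abs_err_succ h]
  nlinarith [abs_err_pos h n, gaussOrbit_lt_one (τ := τ) n]

lemma abs_err_eq (h : Irrational τ) (n : ℕ) :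
    |err τ n| = quot τ n * |err τ (n + 1)| + |err τ (n + 2)| := by
  have h0 := (gaussOrbit_pos h n).ne'
  have h1 := inv_gaussOrbit h n
  rw [abs_err_succ h (n + 1), ← add_mul, ← h1, abs_err_succ h n]
  field_simp

/-- The sign `(-1) ^ (n + 1)` of the `n`-th approximation error. -/
def sgn (n : ℕ) : ℝ := (-1) ^ (n + 1)

lemma sgn_succ (n : ℕ) : sgn (n + 1) = -sgn n := by simp [sgn, pow_succ]

lemma sgn_cases (n : ℕ) : sgn n = 1 ∨ sgn n = -1 := neg_one_pow_eq_or ℝ _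

lemma sgn_mul_self (n : ℕ) : sgn n * sgn n = 1 := by
  rcases sgn_cases n with h | h <;> simp [h]

lemma sgn_mul_err (h : Irrational τ) (n : ℕ) : sgn n * err τ n = |err τ n| := by
  induction n with
  | zero => simp [sgn, err_zero]
  | succ n ih =>
    rw [sgn_succ, abs_err_succ h, err_succ h, ← ih]; ring

lemma err_eq (h : Irrational τ) (n : ℕ) : err τ n = sgn n * |err τ n| := by
  rw [← sgn_mul_err h, ← mul_assoc, sgn_mul_self, one_mul]

/-- As the partial quotient is at least 1, the error at n is at least the sum of the next two. This
is the source of the contraction factor 1/2 in `abs_ratio_sub_le`. -/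
lemma two_mul_abs_err_lt (h : Irrational τ) (n : ℕ) : 2 * |err τ (n + 2)| < |err τ n| := by
  have h1 := abs_err_eq h n
  have h2 := abs_err_succ_lt h (n + 1)
  have h3 : (1 : ℝ) ≤ quot τ n := by exact_mod_cast one_le_quot h n
  nlinarith [abs_err_pos h (n + 1)]

lemma den_mul_num (n : ℕ) :
    (den τ (n + 1) : ℤ) * num τ n - den τ n * num τ (n + 1) = (-1) ^ n := by
  induction n with
  | zero => simp [den, num]
  | succ n ih =>
    rw [pow_succ, ← ih]
    simp only [den, num]; push_cast; ring

lemma isCoprime_num_den (n : ℕ) : IsCoprime (num τ n) (den τ n : ℤ) := by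
  have h := den_mul_num (τ := τ) n
  rcases neg_one_pow_eq_or ℤ n with h1 | h1
  · exact ⟨den τ (n + 1), -num τ (n + 1), by rw [h1] at h; linarith⟩
  · exact ⟨-den τ (n + 1), num τ (n + 1), by rw [h1] at h; linarith⟩

lemma den_succ_pos (h : Irrational τ) (n : ℕ) : 0 < den τ (n + 1) := by
  induction n with
  | zero => simp [den]
  | succ n ih =>
    have := one_le_quot h n
    simp only [den]; positivity

lemma den_le_succ (h : Irrational τ) (n : ℕ) : den τ n ≤ den τ (n + 1) := by
  cases n with
  | zero => simp [den]
  | succ n =>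
    have := one_le_quot h n
    simp only [den]; nlinarith

lemma den_succ_lt (h : Irrational τ) (n : ℕ) : den τ (n + 2) < den τ (n + 3) := by
  have := one_le_quot h (n + 1)
  have := den_succ_pos h n
  have h3 : den τ (n + 3) = quot τ (n + 1) * den τ (n + 2) + den τ (n + 1) := rfl
  nlinarith

lemma le_den (h : Irrational τ) (n : ℕ) : n ≤ den τ (n + 2) := by
  induction n with
  | zero => simp
  | succ n ih => exact ih.trans_lt (den_succ_lt h n)

/-- This is the determinant identity `den_mul_num`: consecutive errors have opposite signs, so the
two products add in absolute value. -/
lemma den_mul_abs_err (h : Irrational τ) (n : ℕ) :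
    den τ (n + 1) * |err τ n| + den τ n * |err τ (n + 1)| = 1 := by
  have h1 := den_mul_num (τ := τ) n
  have h1' : (den τ (n + 1) : ℝ) * num τ n - den τ n * num τ (n + 1) = (-1) ^ n := by
    exact_mod_cast h1
  rw [← sgn_mul_err h, ← sgn_mul_err h, sgn_succ]
  have h2 : sgn n = -(-1) ^ n := by simp [sgn, pow_succ]
  have h3 : ((-1 : ℝ) ^ n) * (-1) ^ n = 1 := by
    have := sgn_mul_self n
    rw [h2] at this; linarith
  rw [h2]
  simp only [err]
  linear_combination (-1 : ℝ) ^ n * h1' + h3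

lemma abs_err_lt_inv (h : Irrational τ) (n : ℕ) : |err τ (n + 1)| < 1 / den τ (n + 1) := by
  have h1 := den_mul_abs_err h (n + 1)
  have h2 : (0 : ℝ) < den τ (n + 1) := by exact_mod_cast den_succ_pos h n
  have h3 : (den τ (n + 1) : ℝ) ≤ den τ (n + 2) := by exact_mod_cast den_le_succ h (n + 1)
  have h4 := abs_err_pos h (n + 1)
  have h5 := abs_err_pos h (n + 2)
  rw [lt_div_iff₀ h2]
  nlinarith

lemma abs_err_le_inv (h : Irrational τ) (n : ℕ) : |err τ n| ≤ 1 / den τ (n + 1) := by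
  have h1 := den_mul_abs_err h n
  have h2 : (0 : ℝ) < den τ (n + 1) := by exact_mod_cast den_succ_pos h n
  rw [le_div_iff₀ h2]
  nlinarith [mul_nonneg (Nat.cast_nonneg (α := ℝ) (den τ n)) (abs_err_pos h (n + 1)).le]

lemma partialQuotientSucc_eq_quot (h : Irrational τ) (n : ℕ) :
    partialQuotientSucc (Int.fract τ) n = quot τ n := by
  have key : ∀ n, ∃ z : ℤ, GenContFract.IntFractPair.stream (Int.fract τ) n =
      some ⟨z, gaussOrbit τ n⟩ := by
    intro n
    induction n with
    | zero =>
      exact ⟨⌊Int.fract τ⌋, by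
        simp [GenContFract.IntFractPair.stream_zero, GenContFract.IntFractPair.of, gaussOrbit]⟩
    | succ n ih =>
      obtain ⟨z, hz⟩ := ih
      refine ⟨⌊(gaussOrbit τ n)⁻¹⌋, ?_⟩
      rw [GenContFract.IntFractPair.stream_succ_of_some hz (gaussOrbit_pos h n).ne']
      rfl
  obtain ⟨z, hz⟩ := key n
  have h1 := GenContFract.IntFractPair.stream_succ_of_some hz (gaussOrbit_pos h n).ne'
  have h2 := GenContFract.get?_of_eq_some_of_succ_get?_intFractPair_stream h1
  have h3 := GenContFract.partDen_eq_s_b h2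
  rw [partialQuotientSucc, h3]
  simp only [Option.getD_some, GenContFract.IntFractPair.of]
  rw [quot, natCast_floor_eq_intCast_floor (inv_pos.2 (gaussOrbit_pos h n)).le]

end ContFrac

/-! ### Return maps -/

section Return

open CircleDeg1Lift

local notation "τ" => translationNumber

lemma lt_map_of_translationNumber_pos {f : CircleDeg1Lift} (h : 0 < τ f) (x : ℝ) : x < f x := by
  have := lt_map_of_int_lt_translationNumber (f := f) (n := 0) (by simpa using h) x
  simpa using this

lemma map_lt_of_translationNumber_neg {f : CircleDeg1Lift} (h : τ f < 0) (x : ℝ) : f x < x := by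
  have := map_lt_of_translationNumber_lt_int (f := f) (n := 0) (by simpa using h) x
  simpa using this

/-- Translation by an integer, as a lift. -/
noncomputable def shift (p : ℤ) : CircleDeg1Lift := translate (Multiplicative.ofAdd (p : ℝ))

lemma shift_apply (p : ℤ) (x : ℝ) : shift p x = p + x := by simp [shift]

lemma shift_add (p r : ℤ) : shift (p + r) = shift p * shift r := by
  ext x; simp only [shift_apply, mul_apply]; push_cast; ring

lemma shift_zero : shift 0 = 1 := by ext x; simp [shift_apply]

lemma shift_nat_mul (k : ℕ) (p : ℤ) : shift (k * p) = shift p ^ k := by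
  induction k with
  | zero => simp [shift_zero]
  | succ k ih => rw [pow_succ, ← ih, ← shift_add]; congr 1; push_cast; ring

lemma commute_shift (f : CircleDeg1Lift) (p : ℤ) : Commute f (shift p) := by
  rw [commute_iff_commute]; intro x; simp [shift_apply]

lemma translationNumber_shift (p : ℤ) : τ (shift p) = p := translationNumber_translate _

/-- The first return maps `F ^ q - p`, where `p / q` are the convergents of the translation number
of `F`. -/
noncomputable def ret (F : CircleDeg1Lift) (m : ℕ) : CircleDeg1Lift :=
  F ^ den (τ F) m * shift (-num (τ F) m)

variable {F : CircleDeg1Lift}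

lemma ret_apply (m : ℕ) (x : ℝ) : ret F m x = F^[den (τ F) m] x - num (τ F) m := by
  rw [ret, mul_apply, shift_apply, map_int_add, coe_pow]; push_cast; ring

lemma ret_zero (x : ℝ) : ret F 0 x = x - 1 := by simp [ret_apply, den, num]

lemma commute_ret (m n : ℕ) : Commute (ret F m) (ret F n) := by
  unfold ret
  exact (((Commute.refl F).pow_pow _ _).mul_right (commute_shift _ _)).mul_left
    ((commute_shift _ _).symm.mul_right (commute_shift _ _))

lemma commute_self_ret (m : ℕ) : Commute F (ret F m) :=
  ((Commute.refl F).pow_right _).mul_right (commute_shift _ _)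

lemma map_ret (m : ℕ) (x : ℝ) : F (ret F m x) = ret F m (F x) :=
  congrArg (fun f : CircleDeg1Lift => f x) (commute_self_ret (F := F) m).eq

lemma iterate_ret (k m : ℕ) (x : ℝ) : F^[k] (ret F m x) = ret F m (F^[k] x) := by
  have := congrArg (fun f : CircleDeg1Lift => f x) ((commute_self_ret (F := F) m).pow_left k).eq
  simpa [coe_pow] using this

lemma ret_comm (m n : ℕ) (x : ℝ) : ret F m (ret F n x) = ret F n (ret F m x) :=
  congrArg (fun f : CircleDeg1Lift => f x) (commute_ret (F := F) m n).eq

lemma ret_pow (m k : ℕ) :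
    ret F m ^ k = F ^ (k * den (τ F) m) * shift (-(k * num (τ F) m)) := by
  rw [ret, (commute_shift _ _).mul_pow, ← pow_mul, ← shift_nat_mul, mul_neg, mul_comm k]

lemma ret_add_two (m : ℕ) : ret F (m + 2) = ret F m * ret F (m + 1) ^ quot (τ F) m := by
  rw [ret_pow, ret, ret, den, num, neg_add, add_comm (-((quot (τ F) m : ℤ) * _)), shift_add,
    add_comm (quot (τ F) m * _), pow_add, mul_assoc, mul_assoc,
    ← mul_assoc (shift _) (F ^ _), ← (commute_shift (F ^ _) _).eq, mul_assoc]

lemma ret_add_two_apply (m : ℕ) (x : ℝ) :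
    ret F (m + 2) x = (ret F (m + 1))^[quot (τ F) m] (ret F m x) := by
  rw [ret_add_two, ((commute_ret m (m + 1)).pow_right _).eq, mul_apply, coe_pow]

lemma translationNumber_ret (m : ℕ) : τ (ret F m) = err (τ F) m := by
  rw [ret, translationNumber_mul_of_commute (commute_shift _ _), translationNumber_pow,
    translationNumber_shift, err]
  push_cast; ring

/-- A nonzero translation number fixes the direction in which every point moves. Order relations
between orbit points are therefore deduced from the arithmetic of `err`. -/
lemma sgn_mul_pos_of_sgn_mul_translationNumber_pos {f : CircleDeg1Lift} {n : ℕ}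
    (h : 0 < sgn n * τ f) (x : ℝ) : 0 < sgn n * (f x - x) := by
  rcases sgn_cases n with h1 | h1 <;> rw [h1] at h ⊢
  · linarith [lt_map_of_translationNumber_pos (f := f) (by linarith) x]
  · linarith [map_lt_of_translationNumber_neg (f := f) (by linarith) x]

lemma sgn_mul_ret_sub_pos (h : Irrational (τ F)) (m : ℕ) (x : ℝ) :
    0 < sgn m * (ret F m x - x) := by
  apply sgn_mul_pos_of_sgn_mul_translationNumber_pos
  rw [translationNumber_ret, sgn_mul_err h]
  exact abs_err_pos h m

end Return

/-! ### Moduli of continuity -/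

section Modulus

variable {ϖ : ℝ → ℝ}

lemma IsModulus.pos (h : IsModulus ϖ) {x : ℝ} (hx : 0 < x) : 0 < ϖ x := by
  have h1 := h.subadd x x hx hx
  have h2 := h.strictMono (mem_Ioi.2 hx) (mem_Ioi.2 (by linarith : 0 < x + x)) (by linarith)
  linarith

lemma IsModulus.mono (h : IsModulus ϖ) {x y : ℝ} (hx : 0 < x) (hxy : x ≤ y) : ϖ x ≤ ϖ y :=
  h.strictMono.monotoneOn hx (mem_Ioi.2 (hx.trans_le hxy)) hxy

/-- A modulus decays at most linearly, so quadratic errors h² can be absorbed into h ϖ(h). -/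
lemma IsModulus.mul_le (h : IsModulus ϖ) {x : ℝ} (hx : 0 < x) (hx1 : x ≤ 1) :
    x * ϖ 1 ≤ 2 * ϖ x := by
  have h1 := h.real_mul x⁻¹ x (inv_pos.2 hx) hx
  rw [inv_mul_cancel₀ hx.ne'] at h1
  have h2 : (⌊x⁻¹⌋ : ℝ) + 1 ≤ 2 * x⁻¹ := by
    have := Int.floor_le x⁻¹
    have := (one_le_inv₀ hx).2 hx1
    linarith
  have h3 : ϖ 1 ≤ 2 * x⁻¹ * ϖ x := h1.trans (mul_le_mul_of_nonneg_right h2 (h.pos hx).le)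
  calc x * ϖ 1 ≤ x * (2 * x⁻¹ * ϖ x) := by gcongr
    _ = 2 * ϖ x := by field_simp

end Modulus

/-! ### Smooth estimates -/

section Smooth

lemma abs_log_sub_log_le {m a b : ℝ} (hm : 0 < m) (ha : m ≤ a) (hb : m ≤ b) :
    |Real.log a - Real.log b| ≤ |a - b| / m := by
  have key : ∀ a b : ℝ, m ≤ a → m ≤ b → Real.log a - Real.log b ≤ |a - b| / m := by
    intro a b ha hb
    have ha' := hm.trans_le ha
    have hb' := hm.trans_le hb
    rw [← Real.log_div ha'.ne' hb'.ne']
    have h1 := Real.log_le_sub_one_of_pos (div_pos ha' hb')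
    have h2 : a / b - 1 = (a - b) / b := by field_simp
    rw [h2] at h1
    refine h1.trans ?_
    calc (a - b) / b ≤ |a - b| / b := by gcongr; exact le_abs_self _
      _ ≤ |a - b| / m := by gcongr
  rw [abs_le]
  constructor
  · have := key b a hb ha
    rw [abs_sub_comm b a] at this; linarith
  · exact key a b ha hb

/-- The difference is half the log of the squared arithmetic mean over the product; that quotient is
at least 1 and exceeds 1 by (a − b)²/(4ab). -/
lemma log_mean_sub_mean_log {m a b : ℝ} (hm : 0 < m) (ha : m ≤ a) (hb : m ≤ b) :
    |Real.log ((a + b) / 2) - (Real.log a + Real.log b) / 2| ≤ (a - b) ^ 2 / m ^ 2 := by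
  have ha' := hm.trans_le ha
  have hb' := hm.trans_le hb
  have hab : 0 < a * b := mul_pos ha' hb'
  have e : Real.log ((a + b) / 2) - (Real.log a + Real.log b) / 2 =
      Real.log (((a + b) / 2) ^ 2 / (a * b)) / 2 := by
    rw [Real.log_div (by positivity) hab.ne', Real.log_mul ha'.ne' hb'.ne', Real.log_pow]
    push_cast; ring
  have h1 : 1 ≤ ((a + b) / 2) ^ 2 / (a * b) := by
    rw [one_le_div hab]; nlinarith [sq_nonneg (a - b)]
  rw [e, abs_of_nonneg (div_nonneg (Real.log_nonneg h1) (by norm_num))]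
  have h2 := Real.log_le_sub_one_of_pos (zero_lt_one.trans_le h1)
  have h3 : ((a + b) / 2) ^ 2 / (a * b) - 1 = (a - b) ^ 2 / (4 * (a * b)) := by
    field_simp; ring
  have h4 : (a - b) ^ 2 / (4 * (a * b)) ≤ (a - b) ^ 2 / m ^ 2 := by
    gcongr; nlinarith
  have h5 : 0 ≤ (a - b) ^ 2 / m ^ 2 := by positivity
  linarith

variable {ϖ : ℝ → ℝ} {F : CircleDeg1Lift}

lemma deriv_add_one (F : CircleDeg1Lift) (x : ℝ) : deriv F (x + 1) = deriv F x := by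
  rw [← deriv_comp_add_const]
  have : (fun x => F (x + 1)) = fun x => F x + 1 := by ext x; simp
  rw [this, deriv_add_const]

namespace IsC2ModulusDiffeoLift

lemma hasDerivAt (hT : IsC2ModulusDiffeoLift ϖ F) (x : ℝ) : HasDerivAt F (deriv F x) x :=
  (hT.contDiff.differentiable (by norm_num) x).hasDerivAt

lemma continuous (hT : IsC2ModulusDiffeoLift ϖ F) : Continuous F := hT.contDiff.continuous

lemma contDiff_deriv (hT : IsC2ModulusDiffeoLift ϖ F) : ContDiff ℝ 1 (deriv F) := by
  have := hT.contDiff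
  rw [show (2 : WithTop ℕ∞) = 1 + 1 by norm_num] at this
  exact (contDiff_succ_iff_deriv.1 this).2.2

lemma hasDerivAt_deriv (hT : IsC2ModulusDiffeoLift ϖ F) (x : ℝ) :
    HasDerivAt (deriv F) (deriv (deriv F) x) x :=
  (hT.contDiff_deriv.differentiable (by norm_num) x).hasDerivAt

lemma continuous_deriv (hT : IsC2ModulusDiffeoLift ϖ F) : Continuous (deriv F) :=
  hT.contDiff_deriv.continuous

lemma continuous_deriv_deriv (hT : IsC2ModulusDiffeoLift ϖ F) : Continuous (deriv (deriv F)) :=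
  hT.contDiff_deriv.continuous_deriv le_rfl

lemma strictMono (hT : IsC2ModulusDiffeoLift ϖ F) : StrictMono F :=
  strictMono_of_deriv_pos hT.deriv_pos

lemma bijective (hT : IsC2ModulusDiffeoLift ϖ F) : Function.Bijective F :=
  ⟨hT.strictMono.injective, F.continuous_iff_surjective.1 hT.continuous⟩

lemma deriv_deriv_add_one (F : CircleDeg1Lift) (x : ℝ) :
    deriv (deriv F) (x + 1) = deriv (deriv F) x := by
  rw [← deriv_comp_add_const]
  congr 1; ext y; exact deriv_add_one F y

/-- The hypothesis covers only [0, 1). Continuity extends it to the endpoint 1, and an interval that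
crosses an integer is split there, at the cost of the factor 2. -/
lemma abs_deriv_deriv_sub_le (hϖ : IsModulus ϖ) (hT : IsC2ModulusDiffeoLift ϖ F) {x y : ℝ}
    (hxy : x < y) (hy : y ≤ x + 1) :
    |deriv (deriv F) x - deriv (deriv F) y| ≤ 2 * ϖ (y - x) := by
  set g := deriv (deriv F) with hg
  have hgc : Continuous g := hT.continuous_deriv_deriv
  have hper : Function.Periodic g 1 := deriv_deriv_add_one F
  have hmod : ∀ x ∈ Ico (0 : ℝ) 1, ∀ y ∈ Ico (0 : ℝ) 1, x < y → |g x - g y| ≤ ϖ (y - x) := by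
    intro x hx y hy hxy
    have := hT.modulus x hx y hy hxy.ne
    rwa [iteratedDeriv_succ, iteratedDeriv_one, abs_sub_comm x y,
      abs_of_pos (sub_pos.2 hxy)] at this
  have hmod1 : ∀ x ∈ Ico (0 : ℝ) 1, |g x - g 1| ≤ ϖ (1 - x) := by
    intro x hx
    have h1 : Tendsto (fun y => |g x - g y|) (𝓝[<] 1) (𝓝 |g x - g 1|) :=
      ((continuous_const.sub hgc).abs.tendsto 1).mono_left nhdsWithin_le_nhds
    have h2 : Tendsto (fun y => ϖ (y - x)) (𝓝[<] 1) (𝓝 (ϖ (1 - x))) := by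
      have h3 : ContinuousAt ϖ (1 - x) :=
        hϖ.continuous.continuousAt (Ioi_mem_nhds (by linarith [hx.2]))
      have h4 : Tendsto (fun y : ℝ => y - x) (𝓝 1) (𝓝 (1 - x)) :=
        (continuous_id.sub continuous_const).tendsto 1
      exact (h3.tendsto.comp h4).mono_left nhdsWithin_le_nhds
    refine le_of_tendsto_of_tendsto h1 h2 ?_
    filter_upwards [Ioo_mem_nhdsLT hx.2] with y hy
    exact hmod x hx y ⟨hx.1.trans hy.1.le, hy.2⟩ hy.1
  have hfl : ∀ z, g (z - ⌊x⌋) = g z := fun z => by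
    have := hper.sub_zsmul_eq (x := z) ⌊x⌋
    simpa using this
  have h0 := Int.floor_le x
  have h1 := Int.lt_floor_add_one x
  rw [← hfl x, ← hfl y, show y - x = (y - ⌊x⌋) - (x - ⌊x⌋) by ring]
  generalize hx' : x - ⌊x⌋ = x'
  generalize hy' : y - ⌊x⌋ = y'
  have hx0 : x' ∈ Ico (0 : ℝ) 1 := ⟨by linarith, by linarith⟩
  have hxy' : x' < y' := by linarith
  have hle : y' ≤ x' + 1 := by linarith
  have hpos := hϖ.pos (sub_pos.2 hxy')
  rcases lt_trichotomy y' 1 with h | h | h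
  · linarith [hmod x' hx0 y' ⟨hx0.1.trans hxy'.le, h⟩ hxy']
  · rw [h] at hpos ⊢
    linarith [hmod1 x' hx0]
  · have e1 : |g x' - g 1| ≤ ϖ (y' - x') :=
      (hmod1 x' hx0).trans (hϖ.mono (by linarith [hx0.2]) (by linarith))
    have e2 : |g 1 - g y'| ≤ ϖ (y' - x') := by
      have e3 : g 1 = g 0 := by simpa using hper 0
      have e4 : g y' = g (y' - 1) := (hper.sub_eq y').symm
      rw [e3, e4]
      refine (hmod 0 ⟨le_rfl, one_pos⟩ (y' - 1) ⟨by linarith, by linarith [hx0.2]⟩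
        (by linarith)).trans (hϖ.mono (by linarith) (by linarith [hx0.2]))
    linarith [abs_sub_le (g x') (g 1) (g y')]

lemma exists_bounds (hT : IsC2ModulusDiffeoLift ϖ F) :
    ∃ m M : ℝ, 0 < m ∧ 0 < M ∧ (∀ x, m ≤ deriv F x) ∧ ∀ x, |deriv (deriv F) x| ≤ M := by
  have per : ∀ g : ℝ → ℝ, Function.Periodic g 1 → ∀ x, ∃ y ∈ Icc (0 : ℝ) 1, g x = g y := by
    intro g hg x
    refine ⟨Int.fract x, ⟨Int.fract_nonneg _, (Int.fract_lt_one _).le⟩, ?_⟩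
    have := hg.sub_zsmul_eq (x := x) ⌊x⌋
    simpa using this.symm
  obtain ⟨a, -, ha⟩ := isCompact_Icc.exists_isMinOn (nonempty_Icc.2 (zero_le_one' ℝ))
    hT.continuous_deriv.continuousOn
  obtain ⟨b, -, hb⟩ := isCompact_Icc.exists_isMaxOn (nonempty_Icc.2 (zero_le_one' ℝ))
    hT.continuous_deriv_deriv.abs.continuousOn
  refine ⟨deriv F a, |deriv (deriv F) b| + 1, hT.deriv_pos a, by positivity, fun x => ?_,
    fun x => ?_⟩
  · obtain ⟨y, hy, e⟩ := per _ (deriv_add_one F) x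
    rw [e]; exact ha hy
  · obtain ⟨y, hy, e⟩ := per _ (deriv_deriv_add_one F) x
    rw [e]
    have : |deriv (deriv F) y| ≤ |deriv (deriv F) b| := hb hy
    linarith

/-- Taylor expansion at x: the second-order terms of the slope and of the mean of the endpoint
derivatives cancel, and only the oscillation of the second derivative remains. -/
lemma abs_slope_sub_mean_le (hϖ : IsModulus ϖ) (hT : IsC2ModulusDiffeoLift ϖ F) {x y : ℝ}
    (hxy : x < y) (hy : y ≤ x + 1) :
    |(F y - F x) / (y - x) - (deriv F x + deriv F y) / 2| ≤ 3 * ((y - x) * ϖ (y - x)) := by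
  set W := 2 * ϖ (y - x) with hW
  have hh : 0 < y - x := sub_pos.2 hxy
  have hWpos : 0 < W := by have := hϖ.pos hh; positivity
  have b2 : ∀ t ∈ Icc x y, |deriv (deriv F) t - deriv (deriv F) x| ≤ W := by
    intro t ht
    rcases eq_or_lt_of_le ht.1 with h | h
    · rw [← h]; simpa using hWpos.le
    · rw [abs_sub_comm]
      refine (abs_deriv_deriv_sub_le hϖ hT h (ht.2.trans hy)).trans ?_
      have := hϖ.mono (sub_pos.2 h) (sub_le_sub_right ht.2 x)
      linarith
  have b1 : ∀ t ∈ Icc x y,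
      |deriv F t - deriv F x - deriv (deriv F) x * (t - x)| ≤ W * (y - x) := by
    intro t ht
    have hd : ∀ s ∈ Icc x y, HasDerivWithinAt
        (fun s => deriv F s - deriv (deriv F) x * (s - x))
        (deriv (deriv F) s - deriv (deriv F) x * 1) (Icc x y) s := fun s _ =>
      ((hT.hasDerivAt_deriv s).sub
        (((hasDerivAt_id s).sub_const x).const_mul _)).hasDerivWithinAt
    have := (convex_Icc x y).norm_image_sub_le_of_norm_hasDerivWithin_le (C := W) hd
      (fun s hs => by simpa using b2 s hs) (left_mem_Icc.2 hxy.le) ht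
    simp only [Real.norm_eq_abs, sub_self, mul_zero, sub_zero] at this
    rw [abs_of_nonneg (sub_nonneg.2 ht.1)] at this
    calc _ = |deriv F t - deriv (deriv F) x * (t - x) - deriv F x| := by congr 1; ring
      _ ≤ W * (t - x) := this
      _ ≤ W * (y - x) := by gcongr; exact ht.2
  have b0 : |F y - F x - deriv F x * (y - x) - deriv (deriv F) x * (y - x) ^ 2 / 2| ≤
      W * (y - x) * (y - x) := by
    have hd : ∀ s ∈ Icc x y, HasDerivWithinAt
        (fun s => F s - deriv F x * (s - x) - deriv (deriv F) x * (s - x) ^ 2 / 2)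
        (deriv F s - deriv F x - deriv (deriv F) x * (s - x)) (Icc x y) s := fun s _ => by
      have h1 := ((hasDerivAt_id s).sub_const x)
      have h2 := ((hT.hasDerivAt s).sub (h1.const_mul (deriv F x))).sub
        (((h1.pow 2).const_mul (deriv (deriv F) x)).div_const 2)
      refine (h2.congr_deriv ?_).hasDerivWithinAt
      simp; ring
    have := (convex_Icc x y).norm_image_sub_le_of_norm_hasDerivWithin_le (C := W * (y - x)) hd
      (fun s hs => b1 s hs) (left_mem_Icc.2 hxy.le) (right_mem_Icc.2 hxy.le)
    simp only [Real.norm_eq_abs, sub_self, mul_zero, sub_zero] at this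
    rw [abs_of_pos hh] at this
    calc _ = |F y - deriv F x * (y - x) - deriv (deriv F) x * (y - x) ^ 2 / 2 -
          (F x - deriv (deriv F) x * 0 ^ 2 / 2)| := by congr 1; ring
      _ ≤ _ := this
  have b3 := b1 y (right_mem_Icc.2 hxy.le)
  have e : (F y - F x) / (y - x) - (deriv F x + deriv F y) / 2 =
      ((F y - F x - deriv F x * (y - x) - deriv (deriv F) x * (y - x) ^ 2 / 2) -
        (deriv F y - deriv F x - deriv (deriv F) x * (y - x)) * (y - x) / 2) / (y - x) := by
    field_simp; ring
  rw [e, abs_div, abs_of_pos hh, div_le_iff₀ hh]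
  refine (abs_sub _ _).trans ?_
  rw [abs_div, abs_mul, abs_of_pos hh, abs_of_pos (zero_lt_two' ℝ)]
  have : |deriv F y - deriv F x - deriv (deriv F) x * (y - x)| * (y - x) ≤
    W * (y - x) * (y - x) := by gcongr
  rw [hW] at *
  nlinarith

lemma exists_trapezoid (hϖ : IsModulus ϖ) (hT : IsC2ModulusDiffeoLift ϖ F) :
    ∃ C : ℝ, 0 < C ∧ ∀ x y : ℝ, x ≠ y → |x - y| ≤ 1 →
      |Real.log ((F y - F x) / (y - x)) - (Real.log (deriv F x) + Real.log (deriv F y)) / 2| ≤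
        C * (|x - y| * ϖ |x - y|) := by
  obtain ⟨m, M, hm, hM, hmF, hMF⟩ := hT.exists_bounds
  have h1 := hϖ.pos one_pos
  refine ⟨3 / m + 2 * M ^ 2 / (m ^ 2 * ϖ 1), by positivity, ?_⟩
  have key : ∀ x y : ℝ, x < y → y ≤ x + 1 →
      |Real.log ((F y - F x) / (y - x)) - (Real.log (deriv F x) + Real.log (deriv F y)) / 2| ≤
        (3 / m + 2 * M ^ 2 / (m ^ 2 * ϖ 1)) * ((y - x) * ϖ (y - x)) := by
    intro x y hxy hy
    have hh : 0 < y - x := sub_pos.2 hxy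
    obtain ⟨c, -, hc⟩ := exists_deriv_eq_slope F hxy hT.continuous.continuousOn
      (hT.contDiff.differentiable (by norm_num)).differentiableOn
    have hS : m ≤ (F y - F x) / (y - x) := hc ▸ hmF c
    have hA : m ≤ (deriv F x + deriv F y) / 2 := by linarith [hmF x, hmF y]
    have t1 := abs_log_sub_log_le hm hS hA
    have t2 := log_mean_sub_mean_log hm (hmF x) (hmF y)
    have t3 := abs_slope_sub_mean_le hϖ hT hxy hy
    have t4 : |deriv F x - deriv F y| ≤ M * (y - x) := by
      have := convex_univ.norm_image_sub_le_of_norm_hasDerivWithin_le (C := M)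
        (fun s _ => (hT.hasDerivAt_deriv s).hasDerivWithinAt) (fun s _ => hMF s)
        (mem_univ y) (mem_univ x)
      rwa [Real.norm_eq_abs, Real.norm_eq_abs, abs_sub_comm x y, abs_of_pos hh] at this
    have t5 : (deriv F x - deriv F y) ^ 2 ≤ M ^ 2 * (y - x) ^ 2 := by
      rw [← sq_abs, ← mul_pow]; gcongr
    have t6 := hϖ.mul_le hh (by linarith)
    have t7 : (deriv F x - deriv F y) ^ 2 / m ^ 2 ≤
        2 * M ^ 2 / (m ^ 2 * ϖ 1) * ((y - x) * ϖ (y - x)) := by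
      rw [div_mul_eq_mul_div, div_le_div_iff₀ (by positivity) (by positivity)]
      calc (deriv F x - deriv F y) ^ 2 * (m ^ 2 * ϖ 1)
          ≤ M ^ 2 * (y - x) ^ 2 * (m ^ 2 * ϖ 1) := by gcongr
        _ = M ^ 2 * (y - x) * m ^ 2 * ((y - x) * ϖ 1) := by ring
        _ ≤ M ^ 2 * (y - x) * m ^ 2 * (2 * ϖ (y - x)) := by gcongr
        _ = _ := by ring
    have t8 : |(F y - F x) / (y - x) - (deriv F x + deriv F y) / 2| / m ≤
        3 / m * ((y - x) * ϖ (y - x)) := by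
      rw [div_mul_eq_mul_div]; gcongr
    rw [add_mul]
    exact (abs_sub_le _ _ _).trans (add_le_add (t1.trans t8) (t2.trans t7))
  intro x y hne hle
  rcases lt_or_gt_of_ne hne with h | h
  · rw [abs_sub_comm x y, abs_of_pos (sub_pos.2 h)] at hle ⊢
    exact key x y h (by linarith)
  · rw [abs_of_pos (sub_pos.2 h)] at hle ⊢
    have := key y x h (by linarith)
    rwa [← neg_sub (F y), ← neg_sub y x, neg_div_neg_eq, neg_sub, add_comm] at this

end IsC2ModulusDiffeoLift

/-! ### The derivative cocycle -/

/-- The logarithm of the derivative of the `n`-th iterate. -/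
noncomputable def logDeriv (F : CircleDeg1Lift) (n : ℕ) (x : ℝ) : ℝ :=
  ∑ i ∈ Finset.range n, Real.log (deriv F (F^[i] x))

lemma logDeriv_zero (x : ℝ) : logDeriv F 0 x = 0 := by simp [logDeriv]

lemma logDeriv_succ (n : ℕ) (x : ℝ) :
    logDeriv F (n + 1) x = logDeriv F n x + Real.log (deriv F (F^[n] x)) :=
  Finset.sum_range_succ _ _

lemma logDeriv_add (n k : ℕ) (x : ℝ) :
    logDeriv F (n + k) x = logDeriv F n x + logDeriv F k (F^[n] x) := by
  rw [logDeriv, Finset.sum_range_add]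
  congr 1
  refine Finset.sum_congr rfl fun i _ => ?_
  rw [← Function.iterate_add_apply, add_comm]

lemma deriv_add_int (F : CircleDeg1Lift) (x : ℝ) (l : ℤ) : deriv F (x + l) = deriv F x := by
  have : Function.Periodic (deriv F) 1 := deriv_add_one F
  simpa using this.int_mul l x

lemma iterate_add_int (F : CircleDeg1Lift) (n : ℕ) (x : ℝ) (l : ℤ) :
    F^[n] (x + l) = F^[n] x + l := by
  rw [← CircleDeg1Lift.coe_pow, CircleDeg1Lift.map_add_int]

lemma logDeriv_add_int (n : ℕ) (x : ℝ) (l : ℤ) : logDeriv F n (x + l) = logDeriv F n x := by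
  simp only [logDeriv, iterate_add_int, deriv_add_int]

lemma logDeriv_sub_int (n : ℕ) (x : ℝ) (l : ℤ) : logDeriv F n (x - l) = logDeriv F n x := by
  have := logDeriv_add_int (F := F) n x (-l)
  rwa [Int.cast_neg, ← sub_eq_add_neg] at this

lemma IsC2ModulusDiffeoLift.hasDerivAt_iterate (hT : IsC2ModulusDiffeoLift ϖ F) (n : ℕ) (x : ℝ) :
    HasDerivAt F^[n] (Real.exp (logDeriv F n x)) x := by
  induction n with
  | zero => simpa [logDeriv_zero] using hasDerivAt_id x
  | succ n ih =>
    rw [Function.iterate_succ', logDeriv_succ, Real.exp_add,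
      Real.exp_log (hT.deriv_pos _), mul_comm]
    exact (hT.hasDerivAt _).comp x ih

lemma IsC2ModulusDiffeoLift.exists_iterate_sub (hT : IsC2ModulusDiffeoLift ϖ F) (n : ℕ)
    (x y : ℝ) : ∃ z, F^[n] y - F^[n] x = Real.exp (logDeriv F n z) * (y - x) := by
  have key : ∀ x y : ℝ, x < y →
      ∃ z, F^[n] y - F^[n] x = Real.exp (logDeriv F n z) * (y - x) := by
    intro x y h
    obtain ⟨c, -, hc⟩ := exists_hasDerivAt_eq_slope F^[n] _ h
      (hT.continuous.iterate n).continuousOn (fun z _ => hT.hasDerivAt_iterate n z)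
    exact ⟨c, by rw [hc, div_mul_cancel₀ _ (sub_pos.2 h).ne']⟩
  rcases lt_trichotomy x y with h | h | h
  · exact key x y h
  · exact ⟨0, by simp [h]⟩
  · obtain ⟨z, hz⟩ := key y x h
    exact ⟨z, by linarith⟩

lemma IsC2ModulusDiffeoLift.log_slope_iterate (hT : IsC2ModulusDiffeoLift ϖ F) (n : ℕ)
    {x y : ℝ} (hxy : x ≠ y) :
    Real.log ((F^[n] y - F^[n] x) / (y - x)) =
      ∑ i ∈ Finset.range n, Real.log ((F (F^[i] y) - F (F^[i] x)) / (F^[i] y - F^[i] x)) := by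
  induction n with
  | zero => simp [div_self (sub_ne_zero.2 hxy.symm)]
  | succ n ih =>
    have h1 : F^[n] y - F^[n] x ≠ 0 :=
      sub_ne_zero.2 fun h => hxy (hT.strictMono.injective.iterate n h).symm
    have h2 : F (F^[n] y) - F (F^[n] x) ≠ 0 :=
      sub_ne_zero.2 fun h => h1 (sub_eq_zero.2 (hT.strictMono.injective h))
    have h3 : y - x ≠ 0 := sub_ne_zero.2 hxy.symm
    rw [Finset.sum_range_succ, ← ih, ← Real.log_mul (div_ne_zero h1 h3) (div_ne_zero h2 h1),
      Function.iterate_succ_apply', Function.iterate_succ_apply']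
    congr 1
    field_simp

/-- The log slope of an iterate is the sum of the log slopes along the orbit, so the errors h_i
ϖ(h_i) add up to at most the total length times ϖ(l). No distortion constant enters. -/
lemma IsC2ModulusDiffeoLift.exists_iterate_trapezoid (hϖ : IsModulus ϖ)
    (hT : IsC2ModulusDiffeoLift ϖ F) :
    ∃ C : ℝ, 0 < C ∧ ∀ (n : ℕ) (x y l : ℝ), 0 < n → x ≠ y → l ≤ 1 →
      (∀ i < n, |F^[i] x - F^[i] y| ≤ l) → ∑ i ∈ Finset.range n, |F^[i] x - F^[i] y| ≤ 3 →
      |Real.log ((F^[n] y - F^[n] x) / (y - x)) - (logDeriv F n x + logDeriv F n y) / 2| ≤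
        C * ϖ l := by
  obtain ⟨C, hC, h⟩ := hT.exists_trapezoid hϖ
  refine ⟨C * 3, by positivity, fun n x y l hn hxy hl hle hsum => ?_⟩
  rw [hT.log_slope_iterate n hxy, logDeriv, logDeriv, ← Finset.sum_add_distrib, Finset.sum_div,
    ← Finset.sum_sub_distrib]
  refine (Finset.abs_sum_le_sum_abs _ _).trans ?_
  have hne : ∀ i, F^[i] x ≠ F^[i] y := fun i h => hxy (hT.strictMono.injective.iterate i h)
  calc _ ≤ ∑ i ∈ Finset.range n, |F^[i] x - F^[i] y| * (C * ϖ l) := by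
        refine Finset.sum_le_sum fun i hi => ?_
        have hi' := hle i (Finset.mem_range.1 hi)
        refine (h _ _ (hne i) (hi'.trans hl)).trans ?_
        have := hϖ.mono (abs_pos.2 (sub_ne_zero.2 (hne i))) hi'
        calc C * (|F^[i] x - F^[i] y| * ϖ |F^[i] x - F^[i] y|)
            ≤ C * (|F^[i] x - F^[i] y| * ϖ l) := by gcongr
          _ = _ := by ring
    _ = (∑ i ∈ Finset.range n, |F^[i] x - F^[i] y|) * (C * ϖ l) := by rw [Finset.sum_mul]
    _ ≤ 3 * (C * ϖ l) := by
        have : 0 < l := (abs_pos.2 (sub_ne_zero.2 (hne 0))).trans_le (hle 0 hn)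
        have := hϖ.pos this
        gcongr
    _ = _ := by ring

end Smooth

/-! ### The Denjoy–Koksma inequality -/

section DenjoyKoksma

open CircleDeg1Lift

/-- Multiplication by p permutes the residues modulo q. -/
lemma sum_range_mul_of_periodic {q : ℕ} (hq : 0 < q) {p : ℤ} (hp : IsCoprime p (q : ℤ))
    {g : ℤ → ℝ} (hg : ∀ k, g (k + q) = g k) :
    ∑ j ∈ Finset.range q, g (j * p) = ∑ k ∈ Finset.range q, g k := by
  have hq' : (0 : ℤ) < q := by exact_mod_cast hq
  have hper : Function.Periodic g (q : ℤ) := hg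
  have hmod : ∀ k : ℤ, g (k % q) = g k := fun k => by
    have := hper.sub_zsmul_eq (x := k) (k / q)
    rw [smul_eq_mul, mul_comm] at this
    rw [← this]; congr 1
    have := Int.emod_add_mul_ediv k q
    linarith
  set i : ℕ → ℕ := fun j => ((j * p) % q).toNat with hi
  have hi' : ∀ j, ((i j : ℕ) : ℤ) = (j * p) % q := fun j =>
    Int.toNat_of_nonneg (Int.emod_nonneg _ hq'.ne')
  have hmem : ∀ j, i j < q := fun j => by
    have := Int.emod_lt_of_pos (j * p) hq'
    rw [← hi'] at this; exact_mod_cast this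
  have hinj : Set.InjOn i (Finset.range q) := by
    intro a ha b hb hab
    have h1 : (a * p : ℤ) % q = (b * p) % q := by rw [← hi', ← hi', hab]
    have h2 : (q : ℤ) ∣ (a - b) * p := by
      rw [sub_mul]
      exact Int.ModEq.dvd (a := b * p) (b := a * p) h1.symm
    have h3 : (q : ℤ) ∣ a - b := hp.symm.dvd_of_dvd_mul_right h2
    have ha' := Finset.mem_range.1 ha
    have hb' := Finset.mem_range.1 hb
    have h4 := Int.eq_zero_of_abs_lt_dvd h3 (by rw [abs_lt]; omega)
    omega
  have himg : (Finset.range q).image i = Finset.range q := by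
    apply Finset.eq_of_subset_of_card_le
    · intro k hk
      obtain ⟨j, -, rfl⟩ := Finset.mem_image.1 hk
      exact Finset.mem_range.2 (hmem j)
    · rw [Finset.card_image_of_injOn hinj]
  conv_rhs => rw [← himg, Finset.sum_image hinj]
  refine Finset.sum_congr rfl fun j _ => ?_
  rw [hi', hmod]

/-- The q cells of length 1/q, visited in the order of multiples of p, cover one period, so the
increments telescope. -/
lemma sum_cells {A : ℝ → ℝ} {c : ℝ} (hA : ∀ t, A (t + 1) = A t + c) {q : ℕ} (hq : 0 < q) {p : ℤ}
    (hp : IsCoprime p (q : ℤ)) (t : ℝ) :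
    ∑ j ∈ Finset.range q, (A (t + (j * p + 1) / q) - A (t + j * p / q)) = c := by
  have hq' : (q : ℝ) ≠ 0 := by exact_mod_cast hq.ne'
  have h := sum_range_mul_of_periodic hq hp
    (g := fun k : ℤ => A (t + (k + 1) / q) - A (t + k / q)) (by
      intro k
      have e1 : t + (((k + q : ℤ) : ℝ) + 1) / q = t + ((k : ℝ) + 1) / q + 1 := by
        push_cast; field_simp; ring
      have e2 : t + (((k + q : ℤ) : ℝ)) / q = t + (k : ℝ) / q + 1 := by
        push_cast; field_simp; ring
      rw [e1, e2, hA, hA]; ring)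
  push_cast at h
  rw [h]
  have := Finset.sum_range_sub (fun k : ℕ => A (t + k / q)) q
  push_cast at this
  rw [this, div_self hq', hA]
  simp

/-- The point `x` lies between the left and the right limits of `H` at `t`. -/
def IsParam (H : CircleDeg1Lift) (t x : ℝ) : Prop :=
  (∀ s < t, H s ≤ x) ∧ ∀ s > t, x ≤ H s

variable {H F : CircleDeg1Lift} {t x : ℝ}

lemma exists_isParam (H : CircleDeg1Lift) (x : ℝ) : ∃ t, IsParam H t x := by
  obtain ⟨a, ha⟩ := (H.tendsto_atBot.eventually_le_atBot x).exists
  obtain ⟨b, hb⟩ := (H.tendsto_atTop.eventually_gt_atTop x).exists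
  have hbdd : BddAbove {s | H s ≤ x} := ⟨b, fun s hs => by
    by_contra hlt
    exact (hs.trans_lt hb).not_ge (H.monotone (not_le.1 hlt).le)⟩
  refine ⟨sSup {s | H s ≤ x}, fun s hs => ?_, fun s hs => ?_⟩
  · obtain ⟨u, hu, hsu⟩ := exists_lt_of_lt_csSup ⟨a, ha⟩ hs
    exact (H.monotone hsu.le).trans hu
  · by_contra hlt
    exact (le_csSup hbdd (not_le.1 hlt).le).not_gt hs

lemma IsParam.add_int (h : IsParam H t x) (l : ℤ) : IsParam H (t + l) (x + l) := by
  constructor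
  · intro s hs
    have := h.1 (s - l) (by linarith)
    rw [map_sub_int] at this; linarith
  · intro s hs
    have := h.2 (s - l) (by linarith)
    rw [map_sub_int] at this; linarith

lemma IsParam.map (hH : ∀ t, H (t + translationNumber F) = F (H t)) (h : IsParam H t x) :
    IsParam H (t + translationNumber F) (F x) := by
  constructor
  · intro s hs
    have := F.monotone (h.1 (s - translationNumber F) (by linarith))
    rwa [← hH, sub_add_cancel] at this
  · intro s hs
    have := F.monotone (h.2 (s - translationNumber F) (by linarith))
    rwa [← hH, sub_add_cancel] at this

lemma IsParam.iterate (hH : ∀ t, H (t + translationNumber F) = F (H t)) (h : IsParam H t x)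
    (n : ℕ) : IsParam H (t + n * translationNumber F) (F^[n] x) := by
  induction n with
  | zero => simpa using h
  | succ n ih =>
    rw [Function.iterate_succ_apply']
    convert ih.map hH using 1
    push_cast; ring

lemma IsParam.ret (hH : ∀ t, H (t + translationNumber F) = F (H t)) (h : IsParam H t x)
    (m : ℕ) : IsParam H (t + err (translationNumber F) m) (ret F m x) := by
  have := (h.iterate hH (den (translationNumber F) m)).add_int (-num (translationNumber F) m)
  rw [ret_apply]
  convert this using 1
  · rw [err]; push_cast; ring
  · push_cast; ring

/-- The semiconjugacy goes from the translation to F and is only known to be monotone. Points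
skipped by its jumps are handled through `IsParam`. -/
lemma exists_semiconj_translation {ϖ : ℝ → ℝ} (hT : IsC2ModulusDiffeoLift ϖ F) :
    ∃ H : CircleDeg1Lift, ∀ t, H (t + translationNumber F) = F (H t) := by
  obtain ⟨H, hH⟩ := semiconj_of_bijective_of_translationNumber_eq
    (f₁ := translate (Multiplicative.ofAdd (translationNumber F))) (f₂ := F)
    (isUnit_iff_bijective.1 (Units.isUnit _)) hT.bijective (translationNumber_translate _)
  refine ⟨H, fun t => ?_⟩
  have := hH t
  rwa [translate_apply, add_comm] at this

/-- The point t + jτ differs from t + jp/q by the drift (j/q)(qτ − p), which stays strictly below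
one cell width. Centring the remaining slack puts the q orbit points strictly inside q distinct
cells modulo 1. -/
lemma exists_grid {τ : ℝ} {q : ℕ} (hq : 0 < q) {p : ℤ} (hD : |q * τ - p| < 1 / q) (t : ℝ) :
    ∃ t₀ : ℝ, ∀ j < q, t₀ + j * p / q < t + j * τ ∧ t + j * τ < t₀ + (j * p + 1) / q := by
  have hq' : (0 : ℝ) < q := by exact_mod_cast hq
  set D := q * τ - p with hDdef
  have key : ∀ j < q, t + j * τ = t + j / q * D + j * p / q := fun j _ => by
    rw [hDdef]; field_simp; ring
  have hj : ∀ j < q, (0 : ℝ) ≤ j / q ∧ (j : ℝ) / q ≤ 1 := fun j hj => by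
    refine ⟨by positivity, ?_⟩
    rw [div_le_one hq']; exact_mod_cast hj.le
  rcases le_total 0 D with h | h
  · rw [abs_of_nonneg h] at hD
    refine ⟨t - (1 / q - D) / 2, fun j hjq => ?_⟩
    obtain ⟨h0, h1⟩ := hj j hjq
    rw [key j hjq, add_div (j * p : ℝ)]
    constructor <;> nlinarith
  · rw [abs_of_nonpos h] at hD
    refine ⟨t + D - (1 / q + D) / 2, fun j hjq => ?_⟩
    obtain ⟨h0, h1⟩ := hj j hjq
    rw [key j hjq, add_div (j * p : ℝ)]
    constructor <;> nlinarith

/-- The total variation of `log F'` over the circle. -/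
noncomputable def totalVar (F : CircleDeg1Lift) : ℝ :=
  ∫ x in (0 : ℝ)..1, |deriv (fun t : ℝ => Real.log (deriv (F : ℝ → ℝ) t)) x|

lemma totalVar_nonneg (F : CircleDeg1Lift) : 0 ≤ totalVar F :=
  intervalIntegral.integral_nonneg zero_le_one fun _ _ => abs_nonneg _

lemma denjoyLambda_eq (F : CircleDeg1Lift) :
    denjoyLambda F = 1 / √(1 + Real.exp (-totalVar F)) := rfl

lemma denjoyLambda_pos (F : CircleDeg1Lift) : 0 < denjoyLambda F := by
  rw [denjoyLambda_eq]; positivity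

lemma denjoyLambda_sq (F : CircleDeg1Lift) :
    denjoyLambda F ^ 2 = 1 / (1 + Real.exp (-totalVar F)) := by
  rw [denjoyLambda_eq, div_pow, one_pow, Real.sq_sqrt (by positivity)]

lemma denjoyLambda_lt_one (F : CircleDeg1Lift) : denjoyLambda F < 1 := by
  have h := denjoyLambda_sq F
  have h1 : 1 / (1 + Real.exp (-totalVar F)) < 1 := by
    rw [div_lt_one (by positivity)]; linarith [Real.exp_pos (-totalVar F)]
  nlinarith [denjoyLambda_pos F]

variable {ϖ : ℝ → ℝ}

namespace IsC2ModulusDiffeoLift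

lemma hasDerivAt_log_deriv (hT : IsC2ModulusDiffeoLift ϖ F) (x : ℝ) :
    HasDerivAt (fun t => Real.log (deriv F t)) (deriv (deriv F) x / deriv F x) x :=
  (hT.hasDerivAt_deriv x).log (hT.deriv_pos x).ne'

/-- The variation function of `log F'`. -/
lemma exists_variation (hT : IsC2ModulusDiffeoLift ϖ F) :
    ∃ V : ℝ → ℝ, Monotone V ∧ (∀ x, V (x + 1) = V x + totalVar F) ∧
      ∀ x y, x ≤ y → |Real.log (deriv F x) - Real.log (deriv F y)| ≤ V y - V x := by
  set g : ℝ → ℝ := fun x => |deriv (fun t : ℝ => Real.log (deriv (F : ℝ → ℝ) t)) x| with hg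
  have hg' : g = fun x => |deriv (deriv F) x / deriv F x| := by
    ext x; rw [hg]; simp only; rw [(hT.hasDerivAt_log_deriv x).deriv]
  have hgc : Continuous g := by
    rw [hg']
    exact (hT.continuous_deriv_deriv.div hT.continuous_deriv fun x => (hT.deriv_pos x).ne').abs
  have hper : Function.Periodic g 1 := fun x => by
    rw [hg']; simp only; rw [deriv_deriv_add_one, deriv_add_one]
  have hsub : ∀ x y, (∫ t in (0 : ℝ)..y, g t) - ∫ t in (0 : ℝ)..x, g t = ∫ t in x..y, g t :=
    fun x y => intervalIntegral.integral_interval_sub_left (hgc.intervalIntegrable _ _)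
      (hgc.intervalIntegrable _ _)
  refine ⟨fun x => ∫ t in (0 : ℝ)..x, g t, fun x y hxy => ?_, fun x => ?_, fun x y hxy => ?_⟩
  · have := intervalIntegral.integral_nonneg (μ := volume) hxy fun t _ => abs_nonneg
      (deriv (fun t : ℝ => Real.log (deriv (F : ℝ → ℝ) t)) t)
    have h2 := hsub x y
    simp only
    linarith
  · have := hsub x (x + 1)
    rw [hper.intervalIntegral_add_eq x 0, zero_add] at this
    simp only [totalVar]
    linarith
  · simp only
    rw [hsub, abs_sub_comm, ← intervalIntegral.integral_eq_sub_of_hasDerivAt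
      (fun t _ => hT.hasDerivAt_log_deriv t)]
    · refine (intervalIntegral.abs_integral_le_integral_abs hxy).trans ?_
      rw [hg']
    · exact (hT.continuous_deriv_deriv.div hT.continuous_deriv
        fun x => (hT.deriv_pos x).ne').intervalIntegrable _ _

/-- Each grid cell contains one orbit point. Replacing log F' there by its average over the cell
costs at most the variation over that cell, and these variations add up to the total one. -/
lemma denjoyKoksma (hT : IsC2ModulusDiffeoLift ϖ F)
    (hH : ∀ t, H (t + translationNumber F) = F (H t)) {q : ℕ} (hq : 0 < q) {p : ℤ}
    (hp : IsCoprime p (q : ℤ)) (hD : |q * translationNumber F - p| < 1 / q) (x : ℝ) :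
    |logDeriv F q x - q * ∫ t in (0 : ℝ)..1, Real.log (deriv F (H t))| ≤ totalVar F := by
  obtain ⟨V, hV, hV1, hVle⟩ := hT.exists_variation
  have hq' : (0 : ℝ) < q := by exact_mod_cast hq
  set φ : ℝ → ℝ := fun t => Real.log (deriv F (H t)) with hφ
  have hφb : ∀ s l r, l ≤ s → s ≤ r → ∀ y, H l ≤ y → y ≤ H r →
      |φ s - Real.log (deriv F y)| ≤ V (H r) - V (H l) := by
    intro s l r hls hsr y hly hyr
    have h1 := H.monotone hls
    have h2 := H.monotone hsr
    rcases le_total (H s) y with h | h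
    · linarith [hVle _ _ h, hV h1, hV hyr]
    · have := hVle _ _ h
      rw [abs_sub_comm] at this
      linarith [hV h2, hV hly]
  have hφper : Function.Periodic φ 1 := fun t => by
    simp only [hφ, map_add_one, deriv_add_one]
  have hφm : Measurable φ :=
    Real.measurable_log.comp (hT.continuous_deriv.measurable.comp H.monotone.measurable)
  have hφi : ∀ a b, IntervalIntegrable φ volume a b := by
    intro a b
    have hb : ∀ s ∈ uIcc a b, |φ s| ≤ |φ (min a b)| + (V (H (max a b)) - V (H (min a b))) := by
      intro s hs
      have := hφb s (min a b) (max a b) hs.1 hs.2 (H (min a b)) le_rfl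
        (H.monotone min_le_max)
      have h3 := abs_sub_abs_le_abs_sub (φ s) (φ (min a b))
      simp only [hφ] at this h3 ⊢
      linarith
    rw [intervalIntegrable_iff]
    refine Measure.integrableOn_of_bounded (M := _) (by simp) hφm.aestronglyMeasurable
      ((ae_restrict_iff' measurableSet_uIoc).2 (.of_forall fun s hs =>
        hb s (uIoc_subset_uIcc hs)))
  set A : ℝ → ℝ := fun t => ∫ s in (0 : ℝ)..t, φ s with hA
  have hAsub : ∀ a b, A b - A a = ∫ s in a..b, φ s := fun a b =>
    intervalIntegral.integral_interval_sub_left (hφi _ _) (hφi _ _)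
  have hA1 : ∀ t, A (t + 1) = A t + ∫ t in (0 : ℝ)..1, φ t := fun t => by
    have := hAsub t (t + 1)
    rw [hφper.intervalIntegral_add_eq t 0, zero_add] at this
    linarith
  obtain ⟨t, ht⟩ := exists_isParam H x
  obtain ⟨t₀, ht₀⟩ := exists_grid hq hD t
  have s1 := sum_cells hA1 hq hp t₀
  have s2 := sum_cells (A := fun t => V (H t)) (c := totalVar F)
    (fun t => by simp only [map_add_one, hV1]) hq hp t₀
  rw [← s1, ← s2, logDeriv, Finset.mul_sum, ← Finset.sum_sub_distrib]
  refine (Finset.abs_sum_le_sum_abs _ _).trans (Finset.sum_le_sum fun j hj => ?_)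
  obtain ⟨g1, g2⟩ := ht₀ j (Finset.mem_range.1 hj)
  have hpar := ht.iterate hH j
  set l := t₀ + j * p / q
  set r := t₀ + (j * p + 1) / q
  have hlr : r - l = 1 / q := by simp only [l, r]; ring
  have hlr' : l ≤ r := (g1.trans g2).le
  set y := F^[j] x
  have hy1 := hpar.1 _ g1
  have hy2 := hpar.2 _ g2
  have e : Real.log (deriv F y) - q * (A r - A l) =
      q * ∫ s in l..r, (Real.log (deriv F y) - φ s) := by
    rw [intervalIntegral.integral_sub (by simp) (hφi _ _), hAsub,
      intervalIntegral.integral_const, hlr, smul_eq_mul]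
    field_simp
  rw [e, abs_mul, abs_of_pos hq']
  have := intervalIntegral.norm_integral_le_of_norm_le_const (a := l) (b := r)
    (f := fun s => Real.log (deriv F y) - φ s) (C := V (H r) - V (H l)) (fun s hs => by
      rw [uIoc_of_le hlr'] at hs
      rw [Real.norm_eq_abs, abs_sub_comm]
      exact hφb s l r hs.1.le hs.2 y hy1 hy2)
  rw [hlr, abs_of_pos (by positivity), Real.norm_eq_abs] at this
  calc _ ≤ q * ((V (H r) - V (H l)) * (1 / q)) := by gcongr
    _ = _ := by field_simp

/-- The mean of log F' vanishes: an iterate maps [0, 1] onto an interval of length 1, so its log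
derivative is zero somewhere, and `denjoyKoksma` then bounds q times the mean for arbitrarily large
q. -/
lemma abs_logDeriv_den_le (hT : IsC2ModulusDiffeoLift ϖ F)
    (hτ : Irrational (translationNumber F)) (m : ℕ) (x : ℝ) :
    |logDeriv F (den (translationNumber F) m) x| ≤ totalVar F := by
  cases m with
  | zero => simpa [den, logDeriv_zero] using totalVar_nonneg F
  | succ m =>
    obtain ⟨H, hH⟩ := exists_semiconj_translation hT
    have key := fun n => hT.denjoyKoksma hH (den_succ_pos hτ n) (isCoprime_num_den (n + 1))
      (abs_err_lt_inv hτ n)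
    set c := ∫ t in (0 : ℝ)..1, Real.log (deriv F (H t)) with hc
    have hc0 : c = 0 := by
      by_contra hne
      obtain ⟨n, hn⟩ := exists_nat_gt (totalVar F / |c|)
      rw [div_lt_iff₀ (abs_pos.2 hne)] at hn
      obtain ⟨z, hz⟩ := hT.exists_iterate_sub (den (translationNumber F) (n + 2)) 0 1
      have h1 := iterate_add_int F (den (translationNumber F) (n + 2)) 0 1
      simp only [Int.cast_one, zero_add] at h1
      rw [h1, add_sub_cancel_left, sub_zero, mul_one] at hz
      have hz0 : logDeriv F (den (translationNumber F) (n + 2)) z = 0 :=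
        Real.exp_eq_one_iff _ |>.1 hz.symm
      have h2 := key (n + 1) z
      rw [hz0, zero_sub, abs_neg, abs_mul, Nat.abs_cast] at h2
      have h3 : (n : ℝ) ≤ den (translationNumber F) (n + 2) := by exact_mod_cast le_den hτ n
      nlinarith [abs_pos.2 hne]
    have := key m x
    rwa [hc0, mul_zero, sub_zero] at this

/-- The rotation counterpart of the return interval has length |err m| ≤ 1/q. Hence both endpoints
of the i-th image lie within the i-th cell and its two neighbours; each of the three families of
cells contributes 1. -/
lemma sum_abs_iterate_sub_ret_le (hT : IsC2ModulusDiffeoLift ϖ F)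
    (hτ : Irrational (translationNumber F)) (m : ℕ) (x : ℝ) :
    ∑ i ∈ Finset.range (den (translationNumber F) (m + 1)),
      |F^[i] x - F^[i] (CircleConj.ret F m x)| ≤ 3 := by
  obtain ⟨H, hH⟩ := exists_semiconj_translation hT
  set q := den (translationNumber F) (m + 1)
  have hq : 0 < q := den_succ_pos hτ m
  have hq' : (0 : ℝ) < q := by exact_mod_cast hq
  obtain ⟨t, ht⟩ := exists_isParam H x
  obtain ⟨t₀, ht₀⟩ := exists_grid hq (abs_err_lt_inv hτ m) t
  have hp := isCoprime_num_den (τ := translationNumber F) (m + 1)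
  set p := num (translationNumber F) (m + 1)
  have s := fun t => sum_cells (A := H) (c := 1) (fun t => by simp) hq hp t
  have h3 : ∑ i ∈ Finset.range q, ((H (t₀ - 1 / q + (i * p + 1) / q) - H (t₀ - 1 / q + i * p / q))
      + (H (t₀ + (i * p + 1) / q) - H (t₀ + i * p / q)) +
      (H (t₀ + 1 / q + (i * p + 1) / q) - H (t₀ + 1 / q + i * p / q))) = 3 := by
    rw [Finset.sum_add_distrib, Finset.sum_add_distrib, s, s, s]; norm_num
  rw [← h3]
  refine Finset.sum_le_sum fun i hi => ?_
  obtain ⟨g1, g2⟩ := ht₀ i (Finset.mem_range.1 hi)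
  have e1 : t₀ - 1 / q + (i * p + 1) / q = t₀ + i * p / q := by ring
  have e2 : t₀ + 1 / q + i * p / q = t₀ + (i * p + 1) / q := by ring
  rw [e1, e2]
  have hd := abs_le.1 (abs_err_le_inv hτ m)
  have p1 := ht.iterate hH i
  have p2 := (ht.iterate hH i).ret hH m
  rw [← iterate_ret] at p2
  have a1 := p1.1 (t₀ - 1 / q + i * p / q) (by linarith [one_div_pos.2 hq'])
  have a2 := p1.2 (t₀ + 1 / q + (i * p + 1) / q) (by linarith [one_div_pos.2 hq'])
  have a3 := p2.1 (t₀ - 1 / q + i * p / q) (by linarith)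
  have a4 := p2.2 (t₀ + 1 / q + (i * p + 1) / q) (by linarith)
  rw [abs_le]
  constructor <;> linarith

end IsC2ModulusDiffeoLift

end DenjoyKoksma

/-! ### Lengths of the return intervals -/

section Lengths

open CircleDeg1Lift

variable {ϖ : ℝ → ℝ} {F : CircleDeg1Lift}

/-- The logarithm of the derivative of the return map `ret F m`. -/
noncomputable def retLog (F : CircleDeg1Lift) (m : ℕ) (x : ℝ) : ℝ :=
  logDeriv F (den (translationNumber F) m) x

/-- The length of the return interval between `x` and `ret F m x`. -/
noncomputable def retLen (F : CircleDeg1Lift) (m : ℕ) (x : ℝ) : ℝ := |ret F m x - x|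

lemma retLen_zero (x : ℝ) : retLen F 0 x = 1 := by simp [retLen, ret_zero]

lemma retLog_zero (x : ℝ) : retLog F 0 x = 0 := by simp [retLog, den, logDeriv_zero]

/-- The chain rule for the two equal compositions of commuting return maps. It lets an increment of
one log derivative be read as an increment of another. -/
lemma retLog_comm (m n : ℕ) (x : ℝ) :
    retLog F n (ret F m x) - retLog F n x = retLog F m (ret F n x) - retLog F m x := by
  have h1 := logDeriv_add (F := F) (den (translationNumber F) m) (den (translationNumber F) n) x
  have h2 := logDeriv_add (F := F) (den (translationNumber F) n) (den (translationNumber F) m) x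
  rw [add_comm (den _ n)] at h2
  simp only [retLog, ret_apply, logDeriv_sub_int]
  linarith

lemma retLen_eq (hτ : Irrational (translationNumber F)) (m : ℕ) (x : ℝ) :
    retLen F m x = sgn m * (ret F m x - x) := by
  have h := sgn_mul_ret_sub_pos hτ m x
  rw [retLen, ← abs_of_pos h, abs_mul]
  rcases sgn_cases m with h1 | h1 <;> simp [h1]

lemma retLen_pos (hτ : Irrational (translationNumber F)) (m : ℕ) (x : ℝ) : 0 < retLen F m x := by
  rw [retLen_eq hτ]; exact sgn_mul_ret_sub_pos hτ m x

lemma sgn_add_two (m : ℕ) : sgn (m + 2) = sgn m := by rw [sgn_succ, sgn_succ, neg_neg]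

lemma sgn_mul_sub_pos_of_strictMono {f : ℝ → ℝ} (hf : StrictMono f) {m : ℕ} {a b : ℝ}
    (h : 0 < sgn m * (f a - f b)) : 0 < sgn m * (a - b) := by
  rcases sgn_cases m with h1 | h1 <;> rw [h1] at h ⊢
  · linarith [hf.lt_iff_lt.1 (show f b < f a by linarith)]
  · linarith [hf.lt_iff_lt.1 (show f a < f b by linarith)]

lemma retLen_le_one (hτ : Irrational (translationNumber F)) (m : ℕ) (x : ℝ) :
    retLen F m x ≤ 1 := by
  cases m with
  | zero => rw [retLen_zero]
  | succ m =>
    have h1 : |err (translationNumber F) (m + 1)| < 1 := by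
      refine (abs_err_lt_inv hτ m).trans_le ?_
      have : (1 : ℝ) ≤ den (translationNumber F) (m + 1) := by exact_mod_cast den_succ_pos hτ m
      rw [div_le_one (by linarith)]; exact this
    rw [← translationNumber_ret, abs_lt] at h1
    have h2 := map_lt_of_translationNumber_lt_int (f := ret F (m + 1)) (n := 1)
      (by simpa using h1.2) x
    have h3 := lt_map_of_int_lt_translationNumber (f := ret F (m + 1)) (n := -1)
      (by simpa using h1.1) x
    push_cast at h2 h3
    rw [retLen, abs_le]
    constructor <;> linarith

namespace IsC2ModulusDiffeoLift

lemma strictMono_ret (hT : IsC2ModulusDiffeoLift ϖ F) (m : ℕ) :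
    StrictMono (CircleConj.ret F m) := by
  intro x y h
  rw [ret_apply, ret_apply]
  linarith [hT.strictMono.iterate (den (translationNumber F) m) h]

lemma continuous_ret (hT : IsC2ModulusDiffeoLift ϖ F) (m : ℕ) :
    Continuous (CircleConj.ret F m) := by
  have : (CircleConj.ret F m : ℝ → ℝ) =
      fun x => F^[den (translationNumber F) m] x - num (translationNumber F) m := by
    ext x; exact ret_apply m x
  rw [this]
  exact (hT.continuous.iterate _).sub continuous_const

lemma surjective_ret (hT : IsC2ModulusDiffeoLift ϖ F) (m : ℕ) :
    Function.Surjective (CircleConj.ret F m) :=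
  (CircleConj.ret F m).continuous_iff_surjective.1 (hT.continuous_ret m)

lemma exists_ret_sub (hT : IsC2ModulusDiffeoLift ϖ F) (m : ℕ) (x y : ℝ) :
    ∃ z, CircleConj.ret F m y - CircleConj.ret F m x = Real.exp (retLog F m z) * (y - x) := by
  obtain ⟨z, hz⟩ := hT.exists_iterate_sub (den (translationNumber F) m) x y
  exact ⟨z, by rw [ret_apply, ret_apply, retLog, ← hz]; ring⟩

lemma abs_retLog_le (hT : IsC2ModulusDiffeoLift ϖ F) (hτ : Irrational (translationNumber F))
    (m : ℕ) (x : ℝ) : |retLog F m x| ≤ totalVar F :=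
  hT.abs_logDeriv_den_le hτ m x

lemma le_sgn_mul_ret_sub (hT : IsC2ModulusDiffeoLift ϖ F)
    (hτ : Irrational (translationNumber F)) (n m : ℕ) {x y : ℝ} (h : 0 ≤ sgn n * (y - x)) :
    Real.exp (-totalVar F) * (sgn n * (y - x)) ≤
      sgn n * (CircleConj.ret F m y - CircleConj.ret F m x) := by
  obtain ⟨z, hz⟩ := hT.exists_ret_sub m x y
  rw [hz, mul_left_comm (sgn n) (Real.exp (retLog F m z))]
  exact mul_le_mul_of_nonneg_right
    (Real.exp_le_exp.2 (abs_le.1 (hT.abs_retLog_le hτ m z)).1) h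

/-- Let z be the preimage of x under `ret F m`. The point `ret F (m + 1) x` lies between z and x,
and `ret F m` carries [z, x] to the return interval of level m with derivative at least exp(−𝒞). -/
lemma retLen_succ_le (hT : IsC2ModulusDiffeoLift ϖ F) (hτ : Irrational (translationNumber F))
    (m : ℕ) (x : ℝ) : retLen F (m + 1) x ≤ Real.exp (totalVar F) * retLen F m x := by
  obtain ⟨z, hz⟩ := hT.surjective_ret m x
  have h1 : 0 < sgn m * (CircleConj.ret F (m + 1) x - z) := by
    apply sgn_mul_sub_pos_of_strictMono (hT.strictMono_ret m)
    rw [hz, ← mul_apply]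
    apply sgn_mul_pos_of_sgn_mul_translationNumber_pos
    rw [translationNumber_mul_of_commute (commute_ret _ _), translationNumber_ret,
      translationNumber_ret, mul_add, sgn_mul_err hτ]
    have := sgn_mul_err hτ (m + 1)
    rw [sgn_succ] at this
    linarith [abs_err_succ_lt hτ m]
  have h2 : 0 < sgn m * (x - z) := by
    have := sgn_mul_ret_sub_pos hτ m z
    rwa [hz] at this
  have h3 := hT.le_sgn_mul_ret_sub hτ m m h2.le
  rw [hz, ← retLen_eq hτ, Real.exp_neg, inv_mul_le_iff₀ (Real.exp_pos _)] at h3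
  refine le_trans ?_ h3
  rw [retLen_eq hτ, sgn_succ]
  linarith

/-- Let w be the preimage of x under the power of `ret F (m + 1)` linking levels m and m + 2, so
that `ret F (m + 2) w = ret F m x`. The interval between x and w contains the return interval of
level m + 2, and its image under `ret F (m + 2)` is exactly the gap between levels m + 2 and m. -/
lemma exp_mul_retLen_add_two_le (hT : IsC2ModulusDiffeoLift ϖ F)
    (hτ : Irrational (translationNumber F)) (m : ℕ) (x : ℝ) :
    Real.exp (-totalVar F) * retLen F (m + 2) x ≤ retLen F m x - retLen F (m + 2) x := by
  set k := quot (translationNumber F) m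
  set f := CircleConj.ret F (m + 1) ^ k with hf
  have hfm : StrictMono f := by
    rw [hf, coe_pow]; exact (hT.strictMono_ret _).iterate _
  have hfs : Function.Surjective f := by
    rw [hf, coe_pow]; exact (hT.surjective_ret _).iterate _
  obtain ⟨w, hw⟩ := hfs x
  have hτf : translationNumber f = k * err (translationNumber F) (m + 1) := by
    rw [hf, translationNumber_pow, translationNumber_ret]
  have h1 : 0 < sgn m * (w - CircleConj.ret F (m + 2) x) := by
    apply sgn_mul_sub_pos_of_strictMono hfm
    rw [hw, ← mul_apply]
    have : 0 < sgn (m + 1) * ((f * CircleConj.ret F (m + 2)) x - x) := by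
      apply sgn_mul_pos_of_sgn_mul_translationNumber_pos
      rw [translationNumber_mul_of_commute ((commute_ret _ _).pow_left _), hτf,
        translationNumber_ret, mul_add, mul_left_comm, sgn_mul_err hτ, sgn_succ]
      have h2 := sgn_mul_err hτ (m + 2)
      rw [sgn_add_two] at h2
      linarith [abs_err_eq hτ m, two_mul_abs_err_lt hτ m]
    rw [sgn_succ] at this
    linarith
  have e1 : CircleConj.ret F m x = CircleConj.ret F (m + 2) w := by
    rw [ret_add_two, mul_apply]
    exact congrArg _ hw.symm
  have h2 : retLen F (m + 2) x ≤ sgn m * (w - x) := by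
    rw [retLen_eq hτ, sgn_add_two]; linarith
  have h3 := hT.le_sgn_mul_ret_sub hτ m (m + 2) ((retLen_pos hτ (m + 2) x).le.trans h2)
  rw [← e1] at h3
  have h4 : retLen F m x - retLen F (m + 2) x =
      sgn m * (CircleConj.ret F m x - CircleConj.ret F (m + 2) x) := by
    rw [retLen_eq hτ, retLen_eq hτ, sgn_add_two]; ring
  rw [h4]
  refine le_trans ?_ h3
  gcongr

lemma retLen_add_two_lt (hT : IsC2ModulusDiffeoLift ϖ F)
    (hτ : Irrational (translationNumber F)) (m : ℕ) (x : ℝ) :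
    retLen F (m + 2) x < retLen F m x := by
  have := hT.exp_mul_retLen_add_two_le hτ m x
  have := mul_pos (Real.exp_pos (-totalVar F)) (retLen_pos hτ (m + 2) x)
  linarith

lemma retLen_add_two_le (hT : IsC2ModulusDiffeoLift ϖ F)
    (hτ : Irrational (translationNumber F)) (m : ℕ) (x : ℝ) :
    retLen F (m + 2) x ≤ denjoyLambda F ^ 2 * retLen F m x := by
  have := hT.exp_mul_retLen_add_two_le hτ m x
  rw [denjoyLambda_sq, one_div, ← div_eq_inv_mul, le_div_iff₀ (by positivity)]
  linarith

lemma retLen_add_le (hT : IsC2ModulusDiffeoLift ϖ F) (hτ : Irrational (translationNumber F))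
    (k i : ℕ) (x : ℝ) : retLen F (k + i) x ≤
      Real.exp (totalVar F) / denjoyLambda F * denjoyLambda F ^ i * retLen F k x := by
  have hl := denjoyLambda_pos F
  have hv : 1 ≤ Real.exp (totalVar F) := Real.one_le_exp (totalVar_nonneg F)
  induction i using Nat.twoStepInduction with
  | zero =>
    have : 1 ≤ Real.exp (totalVar F) / denjoyLambda F := by
      rw [one_le_div hl]; linarith [denjoyLambda_lt_one F]
    have h0 := retLen_pos hτ k x
    simp only [add_zero, pow_zero, mul_one]
    nlinarith
  | one =>
    rw [pow_one, div_mul_cancel₀ _ hl.ne']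
    exact hT.retLen_succ_le hτ k x
  | more i ih _ =>
    refine (hT.retLen_add_two_le hτ (k + i) x).trans ?_
    calc _ ≤ denjoyLambda F ^ 2 * (Real.exp (totalVar F) / denjoyLambda F *
          denjoyLambda F ^ i * retLen F k x) := by gcongr
      _ = _ := by ring

lemma retLen_le (hT : IsC2ModulusDiffeoLift ϖ F) (hτ : Irrational (translationNumber F))
    (m : ℕ) (x : ℝ) :
    retLen F m x ≤ Real.exp (totalVar F) / denjoyLambda F * denjoyLambda F ^ m := by
  have := hT.retLen_add_le hτ 0 m x
  rwa [zero_add, retLen_zero, mul_one] at this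

lemma ret_mem_uIcc (hT : IsC2ModulusDiffeoLift ϖ F) (hτ : Irrational (translationNumber F))
    (m : ℕ) (x : ℝ) : CircleConj.ret F (m + 2) x ∈ uIcc x (CircleConj.ret F m x) := by
  have h1 := hT.retLen_add_two_lt hτ m x
  have h2 := retLen_pos hτ (m + 2) x
  rw [retLen_eq hτ, sgn_add_two] at h1 h2
  rw [retLen_eq hτ] at h1
  rw [mem_uIcc]
  rcases sgn_cases m with h | h <;> rw [h] at h1 h2
  · left; constructor <;> linarith
  · right; constructor <;> linarith

/-- The trapezoid estimate for a return map on the previous return interval. -/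
lemma exists_ret_trapezoid (hϖ : IsModulus ϖ) (hT : IsC2ModulusDiffeoLift ϖ F)
    (hτ : Irrational (translationNumber F)) :
    ∃ C : ℝ, 0 < C ∧ ∀ (m : ℕ) (x a b : ℝ), a ≠ b → a ∈ uIcc x (CircleConj.ret F m x) →
      b ∈ uIcc x (CircleConj.ret F m x) →
      |Real.log ((CircleConj.ret F (m + 1) b - CircleConj.ret F (m + 1) a) / (b - a)) -
        (retLog F (m + 1) a + retLog F (m + 1) b) / 2| ≤ C * ϖ (denjoyLambda F ^ m) := by
  obtain ⟨C, hC, h⟩ := hT.exists_iterate_trapezoid hϖ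
  set C' := Real.exp (totalVar F) / denjoyLambda F with hC'
  have hC'pos : 0 < C' := div_pos (Real.exp_pos _) (denjoyLambda_pos F)
  refine ⟨C * (⌊C'⌋ + 1), mul_pos hC (by
    have : (0 : ℝ) ≤ ⌊C'⌋ := by exact_mod_cast Int.floor_nonneg.2 hC'pos.le
    linarith), fun m x a b hab ha hb => ?_⟩
  have hl : 0 < denjoyLambda F ^ m := pow_pos (denjoyLambda_pos F) m
  have hle : ∀ i, |F^[i] a - F^[i] b| ≤ |F^[i] x - F^[i] (CircleConj.ret F m x)| := fun i => by
    have hm : Monotone F^[i] := (hT.strictMono.iterate i).monotone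
    rw [mem_uIcc] at ha hb
    rw [abs_le]
    rcases le_total x (CircleConj.ret F m x) with hx | hx
    · have ha' : x ≤ a ∧ a ≤ CircleConj.ret F m x := by
        rcases ha with h | h
        · exact h
        · exact ⟨hx.trans h.1, h.2.trans hx⟩
      have hb' : x ≤ b ∧ b ≤ CircleConj.ret F m x := by
        rcases hb with h | h
        · exact h
        · exact ⟨hx.trans h.1, h.2.trans hx⟩
      rw [abs_of_nonpos (sub_nonpos.2 (hm hx))]
      constructor <;> linarith [hm ha'.1, hm ha'.2, hm hb'.1, hm hb'.2]
    · have ha' : CircleConj.ret F m x ≤ a ∧ a ≤ x := by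
        rcases ha with h | h
        · exact ⟨hx.trans h.1, h.2.trans hx⟩
        · exact h
      have hb' : CircleConj.ret F m x ≤ b ∧ b ≤ x := by
        rcases hb with h | h
        · exact ⟨hx.trans h.1, h.2.trans hx⟩
        · exact h
      rw [abs_of_nonneg (sub_nonneg.2 (hm hx))]
      constructor <;> linarith [hm ha'.1, hm ha'.2, hm hb'.1, hm hb'.2]
  have hlen : ∀ i, |F^[i] x - F^[i] (CircleConj.ret F m x)| = retLen F m (F^[i] x) := fun i => by
    rw [iterate_ret, retLen, abs_sub_comm]
  -- The minimum with 1 meets the length restriction of the trapezoid estimate; the constant in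
  -- front of λ^m is later pulled out of the modulus.
  have key := h (den (translationNumber F) (m + 1)) a b (min 1 (C' * denjoyLambda F ^ m))
    (den_succ_pos hτ m) hab (min_le_left _ _)
    (fun i _ => (hle i).trans (le_min ((hlen i).trans_le (retLen_le_one hτ m _))
      ((hlen i).trans_le (hT.retLen_le hτ m _))))
    ((Finset.sum_le_sum fun i _ => hle i).trans (hT.sum_abs_iterate_sub_ret_le hτ m x))
  rw [ret_apply, ret_apply, sub_sub_sub_cancel_right]
  refine key.trans ?_
  rw [mul_assoc]
  gcongr
  exact (hϖ.mono (lt_min one_pos (by positivity)) (min_le_right _ _)).trans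
    (hϖ.real_mul _ _ hC'pos hl)

end IsC2ModulusDiffeoLift

end Lengths

/-! ### Geometric convolutions -/

section Conv

/-- The convolution of `x` with the geometric sequence of ratio `l`. -/
noncomputable def geomConv (l : ℝ) (x : ℕ → ℝ) (m : ℕ) : ℝ :=
  ∑ k ∈ Finset.range (m + 1), x k * l ^ (m - k)

variable {l : ℝ} {x : ℕ → ℝ}

lemma geomConv_zero : geomConv l x 0 = x 0 := by simp [geomConv]

lemma geomConv_succ (m : ℕ) : geomConv l x (m + 1) = l * geomConv l x m + x (m + 1) := by
  rw [geomConv, Finset.sum_range_succ, geomConv, Finset.mul_sum]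
  congr 1
  · refine Finset.sum_congr rfl fun k hk => ?_
    rw [Nat.succ_sub (Nat.lt_succ_iff.1 (Finset.mem_range.1 hk)), pow_succ]; ring
  · simp

lemma geomConv_nonneg (hl : 0 ≤ l) (hx : ∀ k, 0 ≤ x k) (m : ℕ) : 0 ≤ geomConv l x m :=
  Finset.sum_nonneg fun k _ => mul_nonneg (hx k) (pow_nonneg hl _)

lemma le_geomConv (hl : 0 ≤ l) (hx : ∀ k, 0 ≤ x k) (m : ℕ) : x m ≤ geomConv l x m := by
  cases m with
  | zero => rw [geomConv_zero]
  | succ m =>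
    rw [geomConv_succ]
    linarith [mul_nonneg hl (geomConv_nonneg hl hx m)]

lemma geomConv_le_succ (hl : 0 < l) (hx : ∀ k, 0 ≤ x k) (m : ℕ) :
    geomConv l x m ≤ l⁻¹ * geomConv l x (m + 1) := by
  rw [geomConv_succ, mul_add, inv_mul_cancel_left₀ hl.ne']
  linarith [mul_nonneg (inv_pos.2 hl).le (hx (m + 1))]

/-- The submultiplicative bound on A dominates the weighted convolution by the Cauchy product of two
summable series. -/
lemma summable_mul_geomConv {A W : ℕ → ℝ} (hl : 0 ≤ l) (hx : ∀ k, 0 ≤ x k) (hA : ∀ k, 0 ≤ A k)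
    (hAW : ∀ i j, A (i + j) ≤ A i * W j)
    (hWs : Summable fun i => W i * l ^ i) (hs : Summable fun k => A k * x k) :
    Summable fun m => A m * geomConv l x m := by
  have h := (summable_norm_sum_mul_range_of_summable_norm hs.norm hWs.norm)
  refine h.of_nonneg_of_le (fun m => mul_nonneg (hA m) (geomConv_nonneg hl hx m)) fun m => ?_
  rw [geomConv, Finset.mul_sum]
  refine le_trans (Finset.sum_le_sum fun k hk => ?_) (le_abs_self _)
  have hk' : k ≤ m := Nat.lt_succ_iff.1 (Finset.mem_range.1 hk)
  have := hAW k (m - k)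
  rw [Nat.add_sub_cancel' hk'] at this
  calc A m * (x k * l ^ (m - k)) ≤ (A k * W (m - k)) * (x k * l ^ (m - k)) := by
        have := mul_nonneg (hx k) (pow_nonneg hl (m - k))
        gcongr
    _ = _ := by ring

end Conv

/-! ### Derivatives of the return maps -/

section ReturnDerivative

open CircleDeg1Lift

lemma abs_exp_sub_exp_le {v a b : ℝ} (ha : a ≤ v) (hb : b ≤ v) :
    |Real.exp a - Real.exp b| ≤ Real.exp v * |a - b| := by
  have key : ∀ a b : ℝ, a ≤ v → Real.exp a - Real.exp b ≤ Real.exp v * |a - b| := by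
    intro a b ha
    have h1 := Real.add_one_le_exp (b - a)
    have h2 : Real.exp a - Real.exp b = Real.exp a * (1 - Real.exp (b - a)) := by
      rw [mul_sub, ← Real.exp_add]; simp
    rw [h2]
    calc _ ≤ Real.exp a * |a - b| := by
          gcongr; linarith [le_abs_self (a - b)]
      _ ≤ _ := by gcongr
  rw [abs_le]
  constructor
  · have := key b a hb
    rw [abs_sub_comm b a] at this; linarith
  · exact key a b ha

lemma abs_le_exp_mul_abs_exp_sub_one {v a : ℝ} (ha : |a| ≤ v) :
    |a| ≤ Real.exp v * |Real.exp a - 1| := by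
  have hv : 0 ≤ v := (abs_nonneg a).trans ha
  have := abs_log_sub_log_le (Real.exp_pos (-v)) (Real.exp_le_exp.2 (abs_le.1 ha).1)
    (b := 1) (Real.exp_le_one_iff.2 (neg_nonpos.2 hv))
  rwa [Real.log_exp, Real.log_one, sub_zero, Real.exp_neg, div_inv_eq_mul, mul_comm] at this

/-- Among three consecutive points, the total slope is the mean of the two partial ones with weights
A and B, so exp(s₁₃ − s₂₃) − 1 is A/(A + B) times exp(s₁₂ − s₂₃) − 1. By the trapezoid rule s₁₃ −
s₂₃ is close to (α − β)/2 and s₁₂ − s₂₃ to (α − γ)/2. -/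
lemma abs_exp_sub_one_le_of_trapezoid {A B s₁₂ s₂₃ s₁₃ α β γ E v l : ℝ} (hA : 0 < A) (hB : 0 < B)
    (hl : A ≤ l * (A + B)) (hl1 : l ≤ 1)
    (h : A * Real.exp s₁₂ + B * Real.exp s₂₃ = (A + B) * Real.exp s₁₃)
    (h₁₂ : |s₁₂ - (α + β) / 2| ≤ E) (h₂₃ : |s₂₃ - (β + γ) / 2| ≤ E) (h₁₃ : |s₁₃ - (α + γ) / 2| ≤ E)
    (hα : |α| ≤ v) (hβ : |β| ≤ v) (hγ : |γ| ≤ v) (v₁₂ : |s₁₂| ≤ v) (v₂₃ : |s₂₃| ≤ v)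
    (v₁₃ : |s₁₃| ≤ v) :
    |Real.exp ((α - β) / 2) - 1| ≤
      l * |Real.exp ((α - γ) / 2) - 1| + 4 * Real.exp (2 * v) * E := by
  have hAB : 0 < A + B := add_pos hA hB
  have hl0 : 0 ≤ l := by
    by_contra hneg
    have := mul_neg_of_neg_of_pos (not_le.1 hneg) hAB
    linarith
  rw [abs_le] at h₁₂ h₂₃ h₁₃ hα hβ hγ v₁₂ v₂₃ v₁₃
  have e1 : Real.exp (s₁₃ - s₂₃) - 1 = A / (A + B) * (Real.exp (s₁₂ - s₂₃) - 1) := by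
    rw [Real.exp_sub, Real.exp_sub]
    have := Real.exp_pos s₂₃
    field_simp
    linarith
  have hr : A / (A + B) ≤ l := by rwa [div_le_iff₀ hAB]
  have hK := abs_exp_sub_exp_le (v := 2 * v) (a := (α - β) / 2) (b := s₁₃ - s₂₃) (by linarith)
    (by linarith)
  have hM := abs_exp_sub_exp_le (v := 2 * v) (a := s₁₂ - s₂₃) (b := (α - γ) / 2) (by linarith)
    (by linarith)
  have hK' : |(α - β) / 2 - (s₁₃ - s₂₃)| ≤ 2 * E := by rw [abs_le]; constructor <;> linarith
  have hM' : |(s₁₂ - s₂₃) - (α - γ) / 2| ≤ 2 * E := by rw [abs_le]; constructor <;> linarith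
  have hK2 : |Real.exp ((α - β) / 2) - Real.exp (s₁₃ - s₂₃)| ≤ Real.exp (2 * v) * (2 * E) :=
    hK.trans (by gcongr)
  have hM2 : |Real.exp (s₁₂ - s₂₃) - Real.exp ((α - γ) / 2)| ≤ Real.exp (2 * v) * (2 * E) :=
    hM.trans (by gcongr)
  have t1 := abs_sub_le (Real.exp ((α - β) / 2)) (Real.exp (s₁₃ - s₂₃)) 1
  have t2 := abs_sub_le (Real.exp (s₁₂ - s₂₃)) (Real.exp ((α - γ) / 2)) 1
  have t3 : |Real.exp (s₁₃ - s₂₃) - 1| ≤ l * |Real.exp (s₁₂ - s₂₃) - 1| := by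
    rw [e1, abs_mul, abs_of_pos (div_pos hA hAB)]
    gcongr
  have t4 : l * |Real.exp (s₁₂ - s₂₃) - 1| ≤
      l * |Real.exp ((α - γ) / 2) - 1| + 1 * (Real.exp (2 * v) * (2 * E)) := by
    calc _ ≤ l * (Real.exp (2 * v) * (2 * E) + |Real.exp ((α - γ) / 2) - 1|) := by
          gcongr; linarith
      _ = l * |Real.exp ((α - γ) / 2) - 1| + l * (Real.exp (2 * v) * (2 * E)) := by ring
      _ ≤ _ := by
          have := (abs_nonneg _).trans hM2
          gcongr
  linarith

variable {ϖ : ℝ → ℝ} {F : CircleDeg1Lift}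

/-- The logarithmic slope of `ret F m` on the segment between `a` and `b`. -/
noncomputable def logSlope (F : CircleDeg1Lift) (m : ℕ) (a b : ℝ) : ℝ :=
  Real.log ((ret F m b - ret F m a) / (b - a))

/-- Half the increment of `retLog F (m + 1)` over the return interval of level `m`. -/
noncomputable def halfIncr (F : CircleDeg1Lift) (m : ℕ) (x : ℝ) : ℝ :=
  (retLog F (m + 1) (ret F m x) - retLog F (m + 1) x) / 2

lemma halfIncr_zero (x : ℝ) : halfIncr F 0 x = 0 := by
  rw [halfIncr, retLog_comm, retLog_zero, retLog_zero]; simp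

lemma halfIncr_succ (m : ℕ) (x : ℝ) :
    halfIncr F (m + 1) x = (retLog F (m + 1) (ret F (m + 2) x) - retLog F (m + 1) x) / 2 := by
  rw [halfIncr, retLog_comm]

namespace IsC2ModulusDiffeoLift

lemma exp_logSlope_mul (hT : IsC2ModulusDiffeoLift ϖ F) (m : ℕ) {a b : ℝ} (hab : a ≠ b) :
    Real.exp (logSlope F m a b) * (b - a) = CircleConj.ret F m b - CircleConj.ret F m a := by
  obtain ⟨z, hz⟩ := hT.exists_ret_sub m a b
  have h := sub_ne_zero.2 hab.symm
  rw [logSlope, hz, mul_div_cancel_right₀ _ h, Real.exp_log (Real.exp_pos _)]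

lemma abs_logSlope_le (hT : IsC2ModulusDiffeoLift ϖ F) (hτ : Irrational (translationNumber F))
    (m : ℕ) {a b : ℝ} (hab : a ≠ b) : |logSlope F m a b| ≤ totalVar F := by
  obtain ⟨z, hz⟩ := hT.exists_ret_sub m a b
  rw [logSlope, hz, mul_div_cancel_right₀ _ (sub_ne_zero.2 hab.symm), Real.log_exp]
  exact hT.abs_retLog_le hτ m z

lemma abs_halfIncr_le (hT : IsC2ModulusDiffeoLift ϖ F) (hτ : Irrational (translationNumber F))
    (m : ℕ) (x : ℝ) : |halfIncr F m x| ≤ totalVar F := by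
  have h1 := abs_le.1 (hT.abs_retLog_le hτ (m + 1) (CircleConj.ret F m x))
  have h2 := abs_le.1 (hT.abs_retLog_le hτ (m + 1) x)
  rw [halfIncr, abs_le]
  constructor <;> linarith

lemma ret_ne_self (hτ : Irrational (translationNumber F)) (m : ℕ) (x : ℝ) :
    x ≠ CircleConj.ret F m x := by
  have := retLen_pos hτ m x
  rw [retLen] at this
  exact (sub_ne_zero.1 (abs_pos.1 this)).symm

lemma ret_add_two_ne (hT : IsC2ModulusDiffeoLift ϖ F) (hτ : Irrational (translationNumber F))
    (m : ℕ) (x : ℝ) : CircleConj.ret F (m + 2) x ≠ CircleConj.ret F m x := by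
  intro h
  have := hT.retLen_add_two_lt hτ m x
  rw [retLen, retLen, h] at this
  exact lt_irrefl _ this

/-- Everything comes from the trapezoid rule for `ret F (m + 1)` at x, `ret F (m + 2) x` and `ret F
m x`. The endpoint increments are half-increments of levels m and m + 1, the latter by
`halfIncr_succ`; the weight ratio is at most λ², relaxed to λ. -/
lemma exists_logSlope_le (hϖ : IsModulus ϖ) (hT : IsC2ModulusDiffeoLift ϖ F)
    (hτ : Irrational (translationNumber F)) :
    ∃ C : ℝ, 0 < C ∧ ∀ (m : ℕ) (x : ℝ),
      |Real.exp (-halfIncr F (m + 1) x) - 1| ≤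
        denjoyLambda F * |Real.exp (-halfIncr F m x) - 1| + C * ϖ (denjoyLambda F ^ m) ∧
      |logSlope F (m + 1) x (CircleConj.ret F (m + 2) x) -
        logSlope F (m + 1) x (CircleConj.ret F m x)| ≤
          |halfIncr F m x| + |halfIncr F (m + 1) x| + C * ϖ (denjoyLambda F ^ m) ∧
      |retLog F (m + 1) x| ≤ |logSlope F (m + 1) x (CircleConj.ret F m x)| + |halfIncr F m x| +
        C * ϖ (denjoyLambda F ^ m) := by
  obtain ⟨C, hC, h⟩ := hT.exists_ret_trapezoid hϖ hτ
  have hexp : 1 ≤ Real.exp (2 * totalVar F) :=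
    Real.one_le_exp (mul_nonneg zero_le_two (totalVar_nonneg F))
  refine ⟨4 * Real.exp (2 * totalVar F) * C, by positivity, fun m x => ?_⟩
  have hne1 := ret_ne_self hτ (m + 2) x
  have hne2 := hT.ret_add_two_ne hτ m x
  have hne3 := ret_ne_self hτ m x
  have hmem := hT.ret_mem_uIcc hτ m x
  have h12 := h m x x _ hne1 left_mem_uIcc hmem
  have h23 := h m x _ _ hne2 hmem right_mem_uIcc
  have h13 := h m x x _ hne3 left_mem_uIcc right_mem_uIcc
  have v12 := hT.abs_logSlope_le hτ (m + 1) hne1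
  have v23 := hT.abs_logSlope_le hτ (m + 1) hne2
  have v13 := hT.abs_logSlope_le hτ (m + 1) hne3
  have x12 := hT.exp_logSlope_mul (m + 1) hne1
  have x23 := hT.exp_logSlope_mul (m + 1) hne2
  have x13 := hT.exp_logSlope_mul (m + 1) hne3
  rw [← logSlope] at h12 h23 h13
  have w1 := hT.abs_retLog_le hτ (m + 1) x
  have w2 := hT.abs_retLog_le hτ (m + 1) (CircleConj.ret F (m + 2) x)
  have w3 := hT.abs_retLog_le hτ (m + 1) (CircleConj.ret F m x)
  have hE : 0 ≤ C * ϖ (denjoyLambda F ^ m) := (abs_nonneg _).trans h12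
  have hE4 : 2 * (C * ϖ (denjoyLambda F ^ m)) ≤
      4 * Real.exp (2 * totalVar F) * C * ϖ (denjoyLambda F ^ m) := by
    nlinarith
  have hl := denjoyLambda_pos F
  have hl1 := denjoyLambda_lt_one F
  have e1 : -halfIncr F (m + 1) x =
      (retLog F (m + 1) x - retLog F (m + 1) (CircleConj.ret F (m + 2) x)) / 2 := by
    rw [halfIncr_succ]; ring
  have e2 : -halfIncr F m x =
      (retLog F (m + 1) x - retLog F (m + 1) (CircleConj.ret F m x)) / 2 := by
    rw [halfIncr]; ring
  refine ⟨?_, ?_, ?_⟩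
  · have hA := retLen_pos hτ (m + 2) x
    have hAB := hT.retLen_add_two_le hτ m x
    have hB := sub_pos.2 (hT.retLen_add_two_lt hτ m x)
    have := abs_exp_sub_one_le_of_trapezoid (l := denjoyLambda F) hA hB (by
        rw [add_sub_cancel]
        refine hAB.trans ?_
        have := retLen_pos hτ m x
        gcongr; nlinarith) hl1.le (by
        rw [add_sub_cancel, retLen_eq hτ, retLen_eq hτ, sgn_add_two]
        linear_combination sgn m * x12 + sgn m * x23 - sgn m * x13) h12 h23 h13 w1 w2 w3 v12 v23 v13
    rw [e1, e2]
    linarith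
  · have := abs_le.1 h12
    have := abs_le.1 h13
    have i1 : |halfIncr F m x| = |-halfIncr F m x| := (abs_neg _).symm
    rw [halfIncr_succ, i1, e2, abs_le]
    have j1 := neg_abs_le ((retLog F (m + 1) x - retLog F (m + 1) (CircleConj.ret F m x)) / 2)
    have j2 := le_abs_self ((retLog F (m + 1) x - retLog F (m + 1) (CircleConj.ret F m x)) / 2)
    have j3 := neg_abs_le
      ((retLog F (m + 1) (CircleConj.ret F (m + 2) x) - retLog F (m + 1) x) / 2)
    have j4 := le_abs_self
      ((retLog F (m + 1) (CircleConj.ret F (m + 2) x) - retLog F (m + 1) x) / 2)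
    constructor <;> linarith
  · have := abs_le.1 h13
    have i1 : |halfIncr F m x| = |-halfIncr F m x| := (abs_neg _).symm
    rw [i1, e2, abs_le]
    have j1 := neg_abs_le ((retLog F (m + 1) x - retLog F (m + 1) (CircleConj.ret F m x)) / 2)
    have j2 := le_abs_self ((retLog F (m + 1) x - retLog F (m + 1) (CircleConj.ret F m x)) / 2)
    have j3 := neg_abs_le (logSlope F (m + 1) x (CircleConj.ret F m x))
    have j4 := le_abs_self (logSlope F (m + 1) x (CircleConj.ret F m x))
    constructor <;> linarith

/-- Up to sign, both sides are the mixed second difference of the two commuting return maps at x,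
which is symmetric in the levels m and m + 1. -/
lemma retLen_mul_logSlope (hT : IsC2ModulusDiffeoLift ϖ F)
    (hτ : Irrational (translationNumber F)) (m : ℕ) (x : ℝ) :
    retLen F m x * (Real.exp (logSlope F (m + 1) x (CircleConj.ret F m x)) - 1) =
      -(retLen F (m + 1) x *
        (Real.exp (logSlope F m x (CircleConj.ret F (m + 1) x)) - 1)) := by
  have h1 := hT.exp_logSlope_mul (m + 1) (ret_ne_self hτ m x)
  have h2 := hT.exp_logSlope_mul m (ret_ne_self hτ (m + 1) x)
  rw [ret_comm] at h1
  rw [retLen_eq hτ, retLen_eq hτ, sgn_succ]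
  linear_combination sgn m * h1 - sgn m * h2

/-- The return maps are close to isometries, with an error controlled by the modulus. -/
lemma exists_abs_retLog_le (hϖ : IsModulus ϖ) (hT : IsC2ModulusDiffeoLift ϖ F)
    (hτ : Irrational (translationNumber F)) :
    ∃ C : ℝ, 0 < C ∧ ∀ (m : ℕ) (x : ℝ), |retLog F (m + 1) x| ≤
      C * geomConv (denjoyLambda F)
        (geomConv (denjoyLambda F) fun k => ϖ (denjoyLambda F ^ k)) m := by
  obtain ⟨C, hC, h⟩ := hT.exists_logSlope_le hϖ hτ
  have hl := denjoyLambda_pos F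
  have hl1 := denjoyLambda_lt_one F
  set l := denjoyLambda F
  set v := totalVar F with hv
  set e : ℕ → ℝ := fun k => ϖ (l ^ k) with he
  have he0 : ∀ k, 0 ≤ e k := fun k => (hϖ.pos (pow_pos hl k)).le
  set a := geomConv l e with ha
  have ha0 : ∀ k, 0 ≤ a k := geomConv_nonneg hl.le he0
  have hea : ∀ k, e k ≤ a k := le_geomConv hl.le he0
  set J : ℝ := ⌊l⁻¹⌋ + 1 with hJ
  have hJ1 : 1 ≤ J := by
    have : (0 : ℝ) ≤ ⌊l⁻¹⌋ := by exact_mod_cast Int.floor_nonneg.2 (inv_pos.2 hl).le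
    linarith
  have hes : ∀ k, e k ≤ J * e (k + 1) := fun k => by
    have := hϖ.real_mul l⁻¹ (l ^ (k + 1)) (inv_pos.2 hl) (pow_pos hl _)
    rwa [pow_succ', inv_mul_cancel_left₀ hl.ne', ← pow_succ'] at this
  -- First convolution. The recursion starts from zero because `ret F 0` is a translation.
  have hw : ∀ m x, |Real.exp (-halfIncr F m x) - 1| ≤ C * J * a m := by
    intro m x
    induction m with
    | zero =>
      have := ha0 0
      rw [halfIncr_zero]; simp; positivity
    | succ m ih =>
      refine (h m x).1.trans ?_
      rw [ha, geomConv_succ, ← ha]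
      calc _ ≤ l * (C * J * a m) + C * (J * e (m + 1)) := by
            have := hes m
            gcongr
        _ = _ := by ring
  have hμ : ∀ m x, |halfIncr F m x| ≤ Real.exp v * (C * J) * a m := by
    intro m x
    have h1 := abs_le_exp_mul_abs_exp_sub_one (a := -halfIncr F m x) (v := v)
      (by rw [abs_neg]; exact hT.abs_halfIncr_le hτ m x)
    rw [abs_neg] at h1
    refine h1.trans ?_
    rw [mul_assoc]
    gcongr
    exact hw m x
  set M := Real.exp v * (C * J) with hM
  have hMpos : 0 < M := by positivity
  set N := Real.exp v * (M * l⁻¹ + M + C * J) with hN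
  have hNpos : 0 < N := by positivity
  have hstep : ∀ m x, |Real.exp (logSlope F (m + 1) x (CircleConj.ret F (m + 2) x)) - 1| ≤
      |Real.exp (logSlope F (m + 1) x (CircleConj.ret F m x)) - 1| + N * a (m + 1) := by
    intro m x
    have h1 := abs_exp_sub_exp_le (v := v)
      (abs_le.1 (hT.abs_logSlope_le hτ (m + 1) (ret_ne_self hτ (m + 2) x))).2
      (abs_le.1 (hT.abs_logSlope_le hτ (m + 1) (ret_ne_self hτ m x))).2
    have h2 := abs_sub_le (Real.exp (logSlope F (m + 1) x (CircleConj.ret F (m + 2) x)))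
      (Real.exp (logSlope F (m + 1) x (CircleConj.ret F m x))) 1
    have h3 : |logSlope F (m + 1) x (CircleConj.ret F (m + 2) x) -
        logSlope F (m + 1) x (CircleConj.ret F m x)| ≤ (M * l⁻¹ + M + C * J) * a (m + 1) := by
      refine (h m x).2.1.trans ?_
      have i1 := hμ m x
      have i2 := hμ (m + 1) x
      have i3 : M * a m ≤ M * (l⁻¹ * a (m + 1)) := by
        gcongr; exact geomConv_le_succ hl he0 m
      have i4 : C * e m ≤ C * (J * a (m + 1)) := by
        gcongr
        exact (hes m).trans (by gcongr; exact hea _)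
      linarith
    have h4 := mul_le_mul_of_nonneg_left h3 (Real.exp_pos v).le
    rw [← mul_assoc, ← hN] at h4
    linarith
  -- `retLen_mul_logSlope` raises the level at the price of a ratio of consecutive lengths, and
  -- `hstep` moves the endpoint. The ratios telescope, and level 0 contributes nothing.
  have hb : ∀ m x, |Real.exp (logSlope F (m + 1) x (CircleConj.ret F m x)) - 1| ≤
      N * ∑ k ∈ Finset.range m, a (k + 1) * (retLen F (m + 1) x / retLen F (k + 1) x) := by
    intro m x
    induction m with
    | zero =>
      have h1 := hT.retLen_mul_logSlope hτ 0 x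
      have h2 : logSlope F 0 x (CircleConj.ret F 1 x) = 0 := by
        have : CircleConj.ret F 1 x - x ≠ 0 := sub_ne_zero.2 (ret_ne_self hτ 1 x).symm
        simp [logSlope, ret_zero, div_self this]
      rw [zero_add, h2, retLen_zero] at h1
      simp only [Real.exp_zero, sub_self, mul_zero, neg_zero, one_mul] at h1
      rw [zero_add, h1]; simp
    | succ m ih =>
      have h1 := congrArg abs (hT.retLen_mul_logSlope hτ (m + 1) x)
      have p1 := retLen_pos hτ (m + 1) x
      have p2 := retLen_pos hτ (m + 2) x
      rw [abs_neg, abs_mul, abs_mul, abs_of_pos p1, abs_of_pos p2] at h1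
      have h2 : |Real.exp (logSlope F (m + 2) x (CircleConj.ret F (m + 1) x)) - 1| =
          retLen F (m + 2) x / retLen F (m + 1) x *
            |Real.exp (logSlope F (m + 1) x (CircleConj.ret F (m + 2) x)) - 1| := by
        rw [div_mul_eq_mul_div, eq_div_iff p1.ne', mul_comm]; exact h1
      rw [h2]
      calc _ ≤ retLen F (m + 2) x / retLen F (m + 1) x *
            (N * ∑ k ∈ Finset.range m, a (k + 1) * (retLen F (m + 1) x / retLen F (k + 1) x) +
              N * a (m + 1)) := by
            gcongr
            exact (hstep m x).trans (by gcongr)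
        _ = _ := by
            rw [Finset.sum_range_succ, ← mul_add, mul_left_comm, mul_add, Finset.mul_sum]
            congr 1
            congr 1
            · refine Finset.sum_congr rfl fun k _ => ?_
              field_simp
            · rw [mul_comm]
  set P := Real.exp v / l with hP
  have hPpos : 0 < P := by positivity
  have hb' : ∀ m x, |Real.exp (logSlope F (m + 1) x (CircleConj.ret F m x)) - 1| ≤
      N * (P * geomConv l a m) := by
    intro m x
    refine (hb m x).trans ?_
    gcongr
    rw [geomConv, Finset.sum_range_succ', mul_add, Finset.mul_sum]
    refine le_add_of_le_of_nonneg (Finset.sum_le_sum fun k hk => ?_) (by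
      have := ha0 0; positivity)
    have hk' := Finset.mem_range.1 hk
    have h1 := hT.retLen_add_le hτ (k + 1) (m - k) x
    rw [show k + 1 + (m - k) = m + 1 by omega, ← div_le_iff₀ (retLen_pos hτ _ _)] at h1
    -- One factor λ is given away so that the exponent matches the index k + 1 of the convolution.
    have h2 : l ^ (m - k) ≤ l ^ (m - (k + 1)) :=
      pow_le_pow_of_le_one hl.le hl1.le (by omega)
    have := ha0 (k + 1)
    calc _ ≤ a (k + 1) * (P * l ^ (m - k)) := by gcongr
      _ ≤ a (k + 1) * (P * l ^ (m - (k + 1))) := by gcongr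
      _ = _ := by ring
  refine ⟨Real.exp v * (N * P) + M + C, by positivity, fun m x => ?_⟩
  refine (h m x).2.2.trans ?_
  have hs := abs_le_exp_mul_abs_exp_sub_one
    (hT.abs_logSlope_le hτ (m + 1) (ret_ne_self hτ m x))
  have g1 := le_geomConv hl.le ha0 m
  have g2 : Real.exp v * |Real.exp (logSlope F (m + 1) x (CircleConj.ret F m x)) - 1| ≤
      Real.exp v * (N * (P * geomConv l a m)) := by gcongr; exact hb' m x
  have g3 : M * a m ≤ M * geomConv l a m := by gcongr
  have g4 : C * e m ≤ C * geomConv l a m := by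
    gcongr; exact (hea m).trans g1
  have g5 := hμ m x
  linarith

end IsC2ModulusDiffeoLift

end ReturnDerivative

/-! ### The invariant density -/

section Density

open CircleDeg1Lift

/-- The recursion runs backwards: each difference is at most half the next plus an error. Summing
absorbs half of the sum and leaves one last difference, bounded by B and then, once summability is
known, tending to 0. -/
lemma exists_limit_of_half_le {u c : ℕ → ℝ} {B : ℝ} (hc0 : ∀ n, 0 ≤ c n) (hc : Summable c)
    (hB : ∀ n, |u n - u (n + 1)| ≤ B)
    (h : ∀ n, |u n - u (n + 1)| ≤ |u (n + 1) - u (n + 2)| / 2 + c n) :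
    ∃ l, ∀ N, |u N - l| ≤ 2 * ∑' k, c (k + N) := by
  set d : ℕ → ℝ := fun n => |u n - u (n + 1)| with hd
  have hd0 : ∀ n, 0 ≤ d n := fun n => abs_nonneg _
  have key : ∀ N M, ∑ i ∈ Finset.range M, d (N + i) ≤
      d (N + M) + 2 * ∑ i ∈ Finset.range M, c (i + N) := by
    intro N M
    induction M with
    | zero => simpa using hd0 N
    | succ M ih =>
      rw [Finset.sum_range_succ, Finset.sum_range_succ]
      have := h (N + M)
      rw [show N + M + 2 = N + (M + 1) + 1 by ring, show N + M + 1 = N + (M + 1) by ring] at this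
      have e : d (N + M) ≤ d (N + (M + 1)) / 2 + c (M + N) := by rw [add_comm M N]; exact this
      linarith
  have hcN : ∀ N, Summable fun k => c (k + N) := fun N => (summable_nat_add_iff N).2 hc
  have hpart : ∀ N M, ∑ i ∈ Finset.range M, c (i + N) ≤ ∑' k, c (k + N) := fun N M =>
    (hcN N).sum_le_tsum _ fun k _ => hc0 _
  have hds : Summable d := by
    refine summable_of_sum_range_le (c := B + 2 * ∑' k, c (k + 0)) hd0 fun M => ?_
    have h1 := key 0 M
    simp only [zero_add] at h1
    linarith [hB M, hpart 0 M]
  have hcs : CauchySeq u := cauchySeq_of_summable_dist hds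
  obtain ⟨l, hl⟩ := cauchySeq_tendsto_of_complete hcs
  refine ⟨l, fun N => ?_⟩
  have h1 := dist_le_tsum_of_dist_le_of_tendsto d (fun n => le_rfl) hds hl N
  rw [Real.dist_eq] at h1
  refine h1.trans ?_
  have hdN : Summable fun m => d (N + m) := by
    simpa only [add_comm] using (summable_nat_add_iff N).2 hds
  have h2 := hdN.hasSum.tendsto_sum_nat
  have h3 : Tendsto (fun M => d (N + M) + 2 * ∑' k, c (k + N)) atTop
      (𝓝 (0 + 2 * ∑' k, c (k + N))) := hdN.tendsto_atTop_zero.add_const _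
  rw [zero_add] at h3
  exact le_of_tendsto_of_tendsto' h2 h3 fun M => (key N M).trans (by linarith [hpart N M])

variable {ϖ : ℝ → ℝ} {F : CircleDeg1Lift}

lemma abs_logDeriv_mul_le {q : ℕ} {y : ℝ} (h : ∀ x, |logDeriv F q x| ≤ y) (b : ℕ) (x : ℝ) :
    |logDeriv F (b * q) x| ≤ b * y := by
  induction b with
  | zero => simp [logDeriv_zero]
  | succ b ih =>
    rw [Nat.succ_mul, logDeriv_add]
    push_cast
    linarith [abs_add_le (logDeriv F (b * q) x) (logDeriv F q (F^[b * q] x)), h (F^[b * q] x)]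

/-- If the derivatives of the return maps are summably close to `1`, with the partial quotients as
weights, then the derivatives of all iterates are bounded. -/
lemma abs_logDeriv_le_tsum (hτ : Irrational (translationNumber F)) {Y : ℕ → ℝ}
    (hY : ∀ m x, |retLog F m x| ≤ Y m)
    (hs : Summable fun m => quot (translationNumber F) m * Y (m + 1)) (r : ℕ) (x : ℝ) :
    |logDeriv F r x| ≤ ∑' m, quot (translationNumber F) m * Y (m + 1) := by
  have hY0 : ∀ m, 0 ≤ Y m := fun m => (abs_nonneg _).trans (hY m 0)
  have key : ∀ m, ∀ r < den (translationNumber F) (m + 1), ∀ x,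
      |logDeriv F r x| ≤ ∑ i ∈ Finset.range m, quot (translationNumber F) i * Y (i + 1) := by
    intro m
    induction m with
    | zero =>
      intro r hr x
      simp only [den, Nat.lt_one_iff] at hr
      simp [hr, logDeriv_zero]
    | succ m ih =>
      intro r hr x
      set q := den (translationNumber F) (m + 1) with hq
      have hqpos : 0 < q := den_succ_pos hτ m
      have hdm : r / q * q + r % q = r := Nat.div_add_mod' r q
      have hb : r / q ≤ quot (translationNumber F) m := by
        -- Ostrowski expansion: since the previous denominator is at most q, the digit r / q does
        -- not exceed the partial quotient.
        have h1 : r < quot (translationNumber F) m * q + den (translationNumber F) m := hr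
        have h2 : den (translationNumber F) m ≤ q := den_le_succ hτ m
        rw [← Nat.lt_succ_iff, Nat.div_lt_iff_lt_mul hqpos, Nat.succ_mul]
        omega
      rw [← hdm, logDeriv_add, Finset.sum_range_succ, add_comm]
      refine (abs_add_le _ _).trans (add_le_add (ih _ (Nat.mod_lt _ hqpos) _) ?_)
      refine (abs_logDeriv_mul_le (hY (m + 1)) _ _).trans ?_
      have := hY0 (m + 1)
      gcongr
  refine (key (r + 2) r ?_ x).trans (hs.sum_le_tsum _ fun i _ =>
    mul_nonneg (Nat.cast_nonneg _) (hY0 _))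
  exact Nat.lt_of_succ_le (le_den hτ (r + 1))

lemma iterate_ret_eq (m n : ℕ) (x : ℝ) :
    (ret F m)^[n] x = F^[n * den (translationNumber F) m] x -
      ((n * num (translationNumber F) m : ℤ) : ℝ) := by
  rw [← coe_pow, ret_pow, mul_apply, shift_apply, map_int_add, coe_pow]
  push_cast; ring

namespace IsC2ModulusDiffeoLift

lemma tendsto_retLen (hT : IsC2ModulusDiffeoLift ϖ F) (hτ : Irrational (translationNumber F))
    (x : ℝ) : Tendsto (fun m => retLen F m x) atTop (𝓝 0) := by
  have h := (tendsto_pow_atTop_nhds_zero_of_lt_one (denjoyLambda_pos F).le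
    (denjoyLambda_lt_one F)).const_mul (Real.exp (totalVar F) / denjoyLambda F)
  rw [mul_zero] at h
  exact squeeze_zero (fun m => (retLen_pos hτ m x).le) (fun m => hT.retLen_le hτ m x) h

lemma dense_orbit (hT : IsC2ModulusDiffeoLift ϖ F) (hτ : Irrational (translationNumber F))
    (x : ℝ) : Dense {y | ∃ (r : ℕ) (l : ℤ), y = F^[r] x - l} := by
  rw [Metric.dense_iff]
  intro y ε hε
  have h := (tendsto_pow_atTop_nhds_zero_of_lt_one (denjoyLambda_pos F).le
    (denjoyLambda_lt_one F)).const_mul (Real.exp (totalVar F) / denjoyLambda F)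
  rw [mul_zero] at h
  obtain ⟨N, hN⟩ := eventually_atTop.1 (h.eventually (gt_mem_nhds hε))
  set m := 2 * N + 1 with hm
  have hlen : ∀ z, retLen F m z < ε := fun z =>
    (hT.retLen_le hτ m z).trans_lt (hN m (by omega))
  -- At odd levels the return map moves points to the right, by less than ε; its first iterate past
  -- y + l therefore lands within ε of it.
  have hsgn : sgn m = 1 := by
    simp [sgn, hm, pow_succ, pow_mul]
  set f := CircleConj.ret F m with hf
  have hpos : 0 < translationNumber f := by
    rw [hf, translationNumber_ret, err_eq hτ, hsgn, one_mul]
    exact abs_err_pos hτ m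
  obtain ⟨l, hl⟩ := exists_int_gt (x - y)
  have hex : ∃ n, y + l < f^[n] x := by
    have h1 := (tendsto_translationNumber f x).eventually (lt_mem_nhds (half_lt_self hpos))
    have h2 : Tendsto (fun n : ℕ => (n : ℝ) * (translationNumber f / 2)) atTop atTop :=
      tendsto_natCast_atTop_atTop.atTop_mul_const (by positivity)
    obtain ⟨n, hn1, hn2, hn3⟩ :=
      (h1.and ((h2.eventually_gt_atTop (y + l - x)).and (eventually_gt_atTop 0))).exists
    refine ⟨n, ?_⟩
    have hn3' : (0 : ℝ) < n := by exact_mod_cast hn3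
    rw [lt_div_iff₀ hn3', coe_pow] at hn1
    linarith
  classical
  have hfind := Nat.find_spec hex
  have hne : Nat.find hex ≠ 0 := by
    intro h0
    rw [h0] at hfind
    simp only [Function.iterate_zero, id] at hfind
    linarith
  obtain ⟨n, hn⟩ := Nat.exists_eq_succ_of_ne_zero hne
  have hmin := Nat.find_min hex (m := n) (by omega)
  rw [hn, Nat.succ_eq_add_one, Function.iterate_succ_apply'] at hfind
  have h3 := hlen (f^[n] x)
  rw [retLen, ← hf] at h3
  have h4 := le_abs_self (f (f^[n] x) - f^[n] x)
  refine ⟨f^[n + 1] x - l, ?_, ?_⟩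
  · rw [Metric.mem_ball, Real.dist_eq, Function.iterate_succ_apply', abs_lt]
    constructor <;> linarith
  · refine ⟨(n + 1) * den (translationNumber F) m,
      ((n + 1 : ℕ) : ℤ) * num (translationNumber F) m + l, ?_⟩
    rw [hf, iterate_ret_eq]
    push_cast; ring

lemma continuous_retLen (hT : IsC2ModulusDiffeoLift ϖ F) (m : ℕ) : Continuous (retLen F m) :=
  ((hT.continuous_ret m).sub continuous_id).abs

lemma exists_retLen_iterate (hT : IsC2ModulusDiffeoLift ϖ F) (m r : ℕ) (x : ℝ) :
    ∃ z, retLen F m (F^[r] x) = Real.exp (logDeriv F r z) * retLen F m x := by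
  obtain ⟨z, hz⟩ := hT.exists_iterate_sub r x (CircleConj.ret F m x)
  refine ⟨z, ?_⟩
  rw [iterate_ret] at hz
  rw [retLen, hz, abs_mul, abs_of_pos (Real.exp_pos _), retLen]

lemma retLen_sub_int (m : ℕ) (x : ℝ) (l : ℤ) : retLen F m (x - l) = retLen F m x := by
  rw [retLen, retLen, map_sub_int, sub_sub_sub_cancel_right]

/-- A continuous lift moves some point by exactly its translation number, so the length equals that
of the rotation there. Along the orbit of this point lengths change by at most exp(±S), and the
orbit is dense modulo 1. -/
lemma retLen_mem_Icc (hT : IsC2ModulusDiffeoLift ϖ F) (hτ : Irrational (translationNumber F))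
    {S : ℝ} (hS : ∀ r x, |logDeriv F r x| ≤ S) (m : ℕ) (y : ℝ) :
    retLen F m y ∈ Icc (Real.exp (-S) * |err (translationNumber F) m|)
      (Real.exp S * |err (translationNumber F) m|) := by
  obtain ⟨x, hx⟩ := (CircleConj.ret F m).exists_eq_add_translationNumber (hT.continuous_ret m)
  have hx' : retLen F m x = |err (translationNumber F) m| := by
    rw [retLen, hx, add_sub_cancel_left, translationNumber_ret]
  have hcl : IsClosed (retLen F m ⁻¹' Icc (Real.exp (-S) * |err (translationNumber F) m|)
      (Real.exp S * |err (translationNumber F) m|)) :=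
    isClosed_Icc.preimage (hT.continuous_retLen m)
  have hsub : {y | ∃ (r : ℕ) (l : ℤ), y = F^[r] x - l} ⊆
      retLen F m ⁻¹' Icc (Real.exp (-S) * |err (translationNumber F) m|)
        (Real.exp S * |err (translationNumber F) m|) := by
    rintro _ ⟨r, l, rfl⟩
    obtain ⟨z, hz⟩ := hT.exists_retLen_iterate m r x
    have hb := abs_le.1 (hS r z)
    rw [mem_preimage, retLen_sub_int, hz, hx']
    constructor
    · gcongr; exact hb.1
    · gcongr; exact hb.2
  exact hcl.closure_subset_iff.2 hsub ((hT.dense_orbit hτ x).closure_eq ▸ mem_univ y)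

lemma retLen_sub_eq_sum (hτ : Irrational (translationNumber F)) (m : ℕ) (x : ℝ) :
    retLen F m x - retLen F (m + 2) x = ∑ j ∈ Finset.range (quot (translationNumber F) m),
      retLen F (m + 1) ((CircleConj.ret F (m + 1))^[j] (CircleConj.ret F m x)) := by
  have h1 : ∀ j, retLen F (m + 1) ((CircleConj.ret F (m + 1))^[j] (CircleConj.ret F m x)) =
      sgn m * (CircleConj.ret F (m + 1))^[j] (CircleConj.ret F m x) -
        sgn m * (CircleConj.ret F (m + 1))^[j + 1] (CircleConj.ret F m x) := fun j => by
    rw [retLen_eq hτ, sgn_succ, Function.iterate_succ_apply']; ring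
  simp only [h1]
  rw [Finset.sum_range_sub' (fun j => sgn m * (CircleConj.ret F (m + 1))^[j]
    (CircleConj.ret F m x)), ← ret_add_two_apply, retLen_eq hτ, retLen_eq hτ, sgn_add_two]
  simp only [Function.iterate_zero, id]
  ring

/-- The gap between levels m and m + 2 is tiled by images of the return interval of level m + 1, all
of nearly equal length. The errors of the rotation satisfy the exact version of this relation, so
the normalised differences satisfy a recursion with factor |err (m+2)| / |err m| < 1/2. -/
lemma abs_ratio_sub_le (hT : IsC2ModulusDiffeoLift ϖ F) (hτ : Irrational (translationNumber F))
    {S : ℝ} (hS : ∀ r x, |logDeriv F r x| ≤ S) {Y : ℕ → ℝ} (hY : ∀ m x, |retLog F m x| ≤ Y m)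
    (m : ℕ) (x : ℝ) :
    |retLen F m x / (|err (translationNumber F) m|) -
        retLen F (m + 1) x / (|err (translationNumber F) (m + 1)|)| ≤
      |retLen F (m + 1) x / (|err (translationNumber F) (m + 1)|) -
        retLen F (m + 2) x / (|err (translationNumber F) (m + 2)|)| / 2 +
      Real.exp S * Real.exp S * (quot (translationNumber F) m * Y (m + 1) + Y m) := by
  have hY0 : ∀ m, 0 ≤ Y m := fun m => (abs_nonneg _).trans (hY m 0)
  have hS0 : 0 ≤ S := (abs_nonneg _).trans (hS 0 0)
  have d0 := abs_err_pos hτ m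
  have d1 := abs_err_pos hτ (m + 1)
  have d2 := abs_err_pos hτ (m + 2)
  have hd := abs_err_eq hτ m
  have h2d := two_mul_abs_err_lt hτ m
  have hL1 := (hT.retLen_mem_Icc hτ hS (m + 1) x).2
  have hL1pos := retLen_pos hτ (m + 1) x
  set k := quot (translationNumber F) m with hk
  set δ₀ := |err (translationNumber F) m|
  set δ₁ := |err (translationNumber F) (m + 1)|
  set δ₂ := |err (translationNumber F) (m + 2)|
  set θ := k * Y (m + 1) + Y m with hθ
  have hθ0 : 0 ≤ θ := add_nonneg (mul_nonneg (Nat.cast_nonneg _) (hY0 _)) (hY0 _)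
  have hj : ∀ j < k, |retLen F (m + 1) ((CircleConj.ret F (m + 1))^[j] (CircleConj.ret F m x)) -
      retLen F (m + 1) x| ≤ Real.exp S * Real.exp S * θ * δ₁ := by
    intro j hjk
    have e : (CircleConj.ret F (m + 1))^[j] (CircleConj.ret F m x) =
        F^[j * den (translationNumber F) (m + 1) + den (translationNumber F) m] x -
          ((j * num (translationNumber F) (m + 1) + num (translationNumber F) m : ℤ) : ℝ) := by
      rw [iterate_ret_eq, ret_apply, Function.iterate_add_apply, ← coe_pow F, map_sub_int]
      push_cast; ring
    rw [e, retLen_sub_int]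
    obtain ⟨z, hz⟩ := hT.exists_retLen_iterate (m + 1)
      (j * den (translationNumber F) (m + 1) + den (translationNumber F) m) x
    rw [hz]
    set r := j * den (translationNumber F) (m + 1) + den (translationNumber F) m with hr
    have hlog : |logDeriv F r z| ≤ θ := by
      rw [hr, add_comm, logDeriv_add]
      have a1 := abs_add_le (logDeriv F (den (translationNumber F) m) z)
        (logDeriv F (j * den (translationNumber F) (m + 1))
          (F^[den (translationNumber F) m] z))
      have a2 : |logDeriv F (den (translationNumber F) m) z| ≤ Y m := hY m z
      have a3 := abs_logDeriv_mul_le (hY (m + 1)) j (F^[den (translationNumber F) m] z)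
      have a4 : (j : ℝ) * Y (m + 1) ≤ k * Y (m + 1) := by
        have := hY0 (m + 1)
        gcongr
      linarith
    have hexp : |Real.exp (logDeriv F r z) - 1| ≤ Real.exp S * θ := by
      have := abs_exp_sub_exp_le (abs_le.1 (hS r z)).2 hS0
      rw [Real.exp_zero, sub_zero] at this
      exact this.trans (by gcongr)
    calc |Real.exp (logDeriv F r z) * retLen F (m + 1) x - retLen F (m + 1) x|
        = |Real.exp (logDeriv F r z) - 1| * retLen F (m + 1) x := by
          rw [← sub_one_mul, abs_mul, abs_of_pos hL1pos]
      _ ≤ (Real.exp S * θ) * (Real.exp S * δ₁) := by gcongr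
      _ = _ := by ring
  have hsum : |retLen F m x - retLen F (m + 2) x - k * retLen F (m + 1) x| ≤
      k * (Real.exp S * Real.exp S * θ * δ₁) := by
    rw [retLen_sub_eq_sum hτ]
    have : (k : ℝ) * retLen F (m + 1) x = ∑ j ∈ Finset.range k, retLen F (m + 1) x := by simp
    rw [← hk, this, ← Finset.sum_sub_distrib]
    refine (Finset.abs_sum_le_sum_abs _ _).trans ?_
    refine (Finset.sum_le_sum fun j hj' => hj j (Finset.mem_range.1 hj')).trans ?_
    simp
  have hid : δ₀ * (retLen F m x / δ₀ - retLen F (m + 1) x / δ₁) =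
      (retLen F m x - retLen F (m + 2) x - k * retLen F (m + 1) x) -
        δ₂ * (retLen F (m + 1) x / δ₁ - retLen F (m + 2) x / δ₂) := by
    rw [hd]
    field_simp
    ring
  have habs := congrArg abs hid
  rw [abs_mul, abs_of_pos d0] at habs
  have h3 := abs_sub (retLen F m x - retLen F (m + 2) x - k * retLen F (m + 1) x)
    (δ₂ * (retLen F (m + 1) x / δ₁ - retLen F (m + 2) x / δ₂))
  rw [abs_mul δ₂, abs_of_pos d2] at h3
  set a := |retLen F m x / δ₀ - retLen F (m + 1) x / δ₁|
  set b := |retLen F (m + 1) x / δ₁ - retLen F (m + 2) x / δ₂|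
  have hb : 0 ≤ b := abs_nonneg _
  have h4 : k * (Real.exp S * Real.exp S * θ * δ₁) ≤ δ₀ * (Real.exp S * Real.exp S * θ) := by
    have : (k : ℝ) * δ₁ ≤ δ₀ := by linarith
    calc _ = (k * δ₁) * (Real.exp S * Real.exp S * θ) := by ring
      _ ≤ _ := by gcongr
  have h5 : δ₂ * b ≤ δ₀ * (b / 2) := by nlinarith
  have h6 : δ₀ * a ≤ δ₀ * (b / 2 + Real.exp S * Real.exp S * θ) := by linarith
  exact le_of_mul_le_mul_left h6 d0

/-- If the derivatives of the return maps are summably close to `1`, with the partial quotients as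
weights, then there is a continuous positive invariant density. -/
theorem exists_invariant_density (hT : IsC2ModulusDiffeoLift ϖ F)
    (hτ : Irrational (translationNumber F)) {Y : ℕ → ℝ} (hY : ∀ m x, |retLog F m x| ≤ Y m)
    (hs : Summable fun m => quot (translationNumber F) m * Y (m + 1)) :
    ∃ u : ℝ → ℝ, Continuous u ∧ (∀ x, 0 < u x) ∧ (∀ x, u (x + 1) = u x) ∧
      ∀ x, u (F x) = deriv F x * u x := by
  have hY0 : ∀ m, 0 ≤ Y m := fun m => (abs_nonneg _).trans (hY m 0)
  set S := ∑' m, quot (translationNumber F) m * Y (m + 1) with hSdef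
  have hS : ∀ r x, |logDeriv F r x| ≤ S := abs_logDeriv_le_tsum hτ hY hs
  set c : ℕ → ℝ := fun m =>
    Real.exp S * Real.exp S * (quot (translationNumber F) m * Y (m + 1) + Y m) with hc
  have hc0 : ∀ m, 0 ≤ c m := fun m => mul_nonneg (by positivity)
    (add_nonneg (mul_nonneg (Nat.cast_nonneg _) (hY0 _)) (hY0 _))
  have hYs : Summable Y := by
    rw [← summable_nat_add_iff 1]
    refine hs.of_nonneg_of_le (fun m => hY0 _) fun m => ?_
    have : (1 : ℝ) ≤ quot (translationNumber F) m := by exact_mod_cast one_le_quot hτ m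
    nlinarith [hY0 (m + 1)]
  have hcs : Summable c := (hs.add hYs).mul_left _
  set U : ℕ → ℝ → ℝ := fun m x => retLen F m x / |err (translationNumber F) m| with hU
  have hUm : ∀ m x, U m x ∈ Icc (Real.exp (-S)) (Real.exp S) := fun m x => by
    have h := hT.retLen_mem_Icc hτ hS m x
    have d := abs_err_pos hτ m
    exact ⟨(le_div_iff₀ d).2 h.1, (div_le_iff₀ d).2 h.2⟩
  have hlim : ∀ x, ∃ l, ∀ N, |U N x - l| ≤ 2 * ∑' k, c (k + N) := fun x =>
    exists_limit_of_half_le (B := Real.exp S) hc0 hcs (fun n => by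
      have h1 := hUm n x
      have h2 := hUm (n + 1) x
      have := Real.exp_pos (-S)
      rw [abs_le]
      constructor <;> linarith [h1.1, h1.2, h2.1, h2.2])
      fun n => hT.abs_ratio_sub_le hτ hS hY n x
  choose u hu using hlim
  have htail : Tendsto (fun N => 2 * ∑' k, c (k + N)) atTop (𝓝 0) := by
    simpa using (tendsto_sum_nat_add c).const_mul 2
  have hunif : TendstoUniformly U u atTop := by
    rw [Metric.tendstoUniformly_iff]
    intro ε hε
    filter_upwards [htail.eventually (gt_mem_nhds hε)] with N hN x
    rw [dist_comm, Real.dist_eq]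
    exact (hu x N).trans_lt hN
  have hpt : ∀ x, Tendsto (fun m => U m x) atTop (𝓝 (u x)) := fun x => hunif.tendsto_at x
  refine ⟨u, ?_, fun x => ?_, fun x => ?_, fun x => ?_⟩
  · exact hunif.continuous (.of_forall fun m => (hT.continuous_retLen m).div_const _)
  · exact (Real.exp_pos (-S)).trans_le (ge_of_tendsto' (hpt x) fun m => (hUm m x).1)
  · refine tendsto_nhds_unique (hpt (x + 1)) ((hpt x).congr fun m => ?_)
    have := retLen_sub_int (F := F) m (x + 1) 1
    rw [Int.cast_one, add_sub_cancel_right] at this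
    simp only [hU, this]
  · have hret : Tendsto (fun m => CircleConj.ret F m x) atTop (𝓝[≠] x) := by
      refine tendsto_nhdsWithin_iff.2 ⟨?_, .of_forall fun m => (ret_ne_self hτ m x).symm⟩
      rw [tendsto_iff_dist_tendsto_zero]
      exact hT.tendsto_retLen hτ x
    have hsl := (hasDerivAt_iff_tendsto_slope.1 (hT.hasDerivAt x)).comp hret
    -- The return interval at F x is the F-image of the one at x, so the ratio of the two lengths is
    -- a difference quotient of F along a sequence tending to x.
    refine tendsto_nhds_unique (hpt (F x)) ((hsl.mul (hpt x)).congr fun m => ?_)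
    have hne := ret_ne_self hτ m x
    have hpos : 0 < slope F x (CircleConj.ret F m x) := by
      rw [slope_def_field]
      rcases lt_or_gt_of_ne hne with h | h
      · exact div_pos (sub_pos.2 (hT.strictMono h)) (sub_pos.2 h)
      · exact div_pos_of_neg_of_neg (sub_neg.2 (hT.strictMono h)) (sub_neg.2 h)
    have e : retLen F m (F x) = slope F x (CircleConj.ret F m x) * retLen F m x := by
      have h1 : F (CircleConj.ret F m x) - F x =
          slope F x (CircleConj.ret F m x) * (CircleConj.ret F m x - x) := by
        rw [slope_def_field, div_mul_cancel₀ _ (sub_ne_zero.2 hne.symm)]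
      rw [retLen, retLen, ← map_ret, h1, abs_mul, abs_of_pos hpos]
    simp only [hU, Function.comp, e]
    ring

end IsC2ModulusDiffeoLift

end Density

/-! ### From an invariant density to the conjugacy -/

section Conjugacy

open CircleDeg1Lift

lemma coe_eq_coe_iff {x y : ℝ} : (x : UnitAddCircle) = y ↔ ∃ n : ℤ, x = y + n := by
  rw [← sub_eq_zero, ← AddCircle.coe_sub, AddCircle.coe_eq_zero_iff]
  constructor
  · rintro ⟨n, hn⟩
    exact ⟨n, by simp at hn; linarith⟩
  · rintro ⟨n, hn⟩
    exact ⟨n, by simp [hn]⟩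

lemma coe_fract (x : ℝ) : ((Int.fract x : ℝ) : UnitAddCircle) = x :=
  coe_eq_coe_iff.2 ⟨-⌊x⌋, by rw [← Int.self_sub_floor]; push_cast; ring⟩

lemma exists_homeomorph_of_lift {h : CircleDeg1Lift} (hm : StrictMono h) (hc : Continuous h) :
    ∃ φ : UnitAddCircle ≃ₜ UnitAddCircle, IsLift h φ := by
  have hper : Function.Periodic (fun x : ℝ => (h x : UnitAddCircle)) 1 := fun x =>
    coe_eq_coe_iff.2 ⟨1, by simp⟩
  set f : UnitAddCircle → UnitAddCircle := hper.lift with hf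
  have hfx : ∀ x : ℝ, f x = (h x : UnitAddCircle) := fun x => hper.lift_coe x
  have hfc : Continuous f := by
    rw [hf]
    refine continuous_coinduced_dom.2 ?_
    exact (AddCircle.continuous_mk' 1).comp hc
  have hbij : Function.Bijective f := by
    constructor
    · intro a b hab
      induction a using QuotientAddGroup.induction_on with | H x => ?_
      induction b using QuotientAddGroup.induction_on with | H y => ?_
      rw [hfx, hfx] at hab
      obtain ⟨n, hn⟩ := coe_eq_coe_iff.1 hab
      rw [← map_add_int] at hn
      exact coe_eq_coe_iff.2 ⟨n, hm.injective hn⟩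
    · intro b
      induction b using QuotientAddGroup.induction_on with | H y => ?_
      obtain ⟨x, hx⟩ := h.continuous_iff_surjective.1 hc y
      exact ⟨x, by rw [hfx, hx]⟩
  exact ⟨Continuous.homeoOfEquivCompactToT2 (f := Equiv.ofBijective f hbij) hfc, hfx⟩

variable {ϖ : ℝ → ℝ} {F : CircleDeg1Lift}

lemma IsC2ModulusDiffeoLift.exists_conjugacy_lift (hT : IsC2ModulusDiffeoLift ϖ F) {u : ℝ → ℝ}
    (hu : Continuous u) (hpos : ∀ x, 0 < u x) (hper : ∀ x, u (x + 1) = u x)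
    (hinv : ∀ x, u (F x) = deriv F x * u x) :
    ∃ h : CircleDeg1Lift, ContDiff ℝ 1 h ∧ (∀ x, 0 < deriv h x) ∧
      ∀ x, h (F x) = h x + translationNumber F := by
  have hw : Continuous fun x => (u x)⁻¹ := hu.inv₀ fun x => (hpos x).ne'
  have hwper : Function.Periodic (fun x => (u x)⁻¹) 1 := fun x => by simp only [hper]
  set κ := ∫ t in (0 : ℝ)..1, (u t)⁻¹ with hκ
  have hκpos : 0 < κ := intervalIntegral.intervalIntegral_pos_of_pos
    (hw.intervalIntegrable _ _) (fun x => inv_pos.2 (hpos x)) one_pos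
  set g : ℝ → ℝ := fun x => (∫ t in (0 : ℝ)..x, (u t)⁻¹) / κ with hg
  have hd : ∀ x, HasDerivAt g ((u x)⁻¹ / κ) x := fun x =>
    (intervalIntegral.integral_hasDerivAt_right (hw.intervalIntegrable _ _)
      (hw.stronglyMeasurableAtFilter _ _) hw.continuousAt).div_const κ
  have hderiv : deriv g = fun x => (u x)⁻¹ / κ := by ext x; exact (hd x).deriv
  have hmono : StrictMono g := strictMono_of_deriv_pos fun x => by
    rw [hderiv]; exact div_pos (inv_pos.2 (hpos x)) hκpos
  have hg1 : ∀ x, g (x + 1) = g x + 1 := fun x => by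
    have h1 := intervalIntegral.integral_interval_sub_left (μ := volume)
      (hw.intervalIntegrable 0 (x + 1)) (hw.intervalIntegrable 0 x)
    rw [hwper.intervalIntegral_add_eq x 0, zero_add, ← hκ] at h1
    simp only [hg]
    rw [eq_add_of_sub_eq h1, add_div, div_self hκpos.ne', add_comm]
  set h : CircleDeg1Lift := ⟨⟨g, hmono.monotone⟩, hg1⟩ with hh
  have hhg : (h : ℝ → ℝ) = g := rfl
  -- Invariance of the density says precisely that this difference has zero derivative; the constant
  -- is then identified as the translation number through the semiconjugacy.
  have hconst : ∀ x, g (F x) - g x = g (F 0) - g 0 := by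
    have hd2 : ∀ x, HasDerivAt (fun x => g (F x) - g x) 0 x := fun x => by
      have := ((hd (F x)).comp x (hT.hasDerivAt x)).sub (hd x)
      refine this.congr_deriv ?_
      rw [hinv]
      have := (hT.deriv_pos x).ne'
      have := (hpos x).ne'
      field_simp; ring
    exact fun x => is_const_of_deriv_eq_zero (fun x => (hd2 x).differentiableAt)
      (fun x => (hd2 x).deriv) x 0
  have hτ : translationNumber F = g (F 0) - g 0 := by
    rw [← translationNumber_translate (g (F 0) - g 0)]
    refine translationNumber_eq_of_semiconj (f := h) fun x => ?_
    rw [CircleDeg1Lift.translate_apply, hhg, ← hconst x]; ring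
  refine ⟨h, ?_, fun x => ?_, fun x => ?_⟩
  · rw [contDiff_one_iff_deriv, hhg, hderiv]
    exact ⟨fun x => (hd x).differentiableAt, hw.div_const _⟩
  · rw [hhg, hderiv]; exact div_pos (inv_pos.2 (hpos x)) hκpos
  · rw [hτ, hhg, ← hconst x]; ring

/-- A continuous positive invariant density yields a `C¹` conjugacy to the rotation. -/
theorem IsC2ModulusDiffeoLift.admitsC1Conjugacy_of_density (hT : IsC2ModulusDiffeoLift ϖ F)
    {T : UnitAddCircle ≃ₜ UnitAddCircle} (hF : IsLift F T)
    (hρ : Irrational (rotationNumber F)) {u : ℝ → ℝ}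
    (hu : Continuous u) (hpos : ∀ x, 0 < u x) (hper : ∀ x, u (x + 1) = u x)
    (hinv : ∀ x, u (F x) = deriv F x * u x) : AdmitsC1Conjugacy T (rotationNumber F) := by
  obtain ⟨h, hC1, hd, hconj⟩ := hT.exists_conjugacy_lift hu hpos hper hinv
  obtain ⟨φ₀, hφ₀⟩ := exists_homeomorph_of_lift (strictMono_of_deriv_pos hd) hC1.continuous
  have hcoe : ((rotationNumber F : ℝ) : UnitAddCircle) = (translationNumber F : ℝ) := coe_fract _
  have h0 : ∀ y, φ₀ (T y) = φ₀ y + (rotationNumber F : UnitAddCircle) := by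
    intro y
    induction y using QuotientAddGroup.induction_on with | H x => ?_
    have e1 := hF x
    have e2 := hφ₀ x
    have e3 := hφ₀ (F x)
    rw [hconj, AddCircle.coe_add] at e3
    rw [hcoe]
    exact (congrArg φ₀ e1).trans (e3.trans (by rw [← e2]))
  refine ⟨⟨φ₀, fun θ => by rw [h0, φ₀.apply_symm_apply]⟩, fun φ hφ => ?_⟩
  have h1 : ∀ y, φ (T y) = φ y + (rotationNumber F : UnitAddCircle) := fun y => by
    have := hφ (φ y)
    rwa [φ.symm_apply_apply] at this
  -- The difference of the two conjugacies is a continuous function invariant under the irrational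
  -- rotation, hence constant on a dense orbit and everywhere.
  set k : UnitAddCircle → UnitAddCircle := fun θ => φ (φ₀.symm θ) - θ with hk
  have hkc : Continuous k := (φ.continuous.comp φ₀.symm.continuous).sub continuous_id
  have hkρ : ∀ θ, k (θ + (rotationNumber F : UnitAddCircle)) = k θ := fun θ => by
    have e : φ₀.symm (θ + (rotationNumber F : UnitAddCircle)) = T (φ₀.symm θ) := by
      rw [φ₀.symm_apply_eq, h0, φ₀.apply_symm_apply]
    simp only [hk, e, h1]
    abel
  have hkper : Function.Periodic k (rotationNumber F : UnitAddCircle) := hkρ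
  have hdense : DenseRange fun n : ℤ => n • (rotationNumber F : UnitAddCircle) :=
    AddCircle.denseRange_zsmul_coe_iff.2 (by simpa using hρ)
  have hkconst : k = fun _ => k 0 := by
    refine hdense.equalizer hkc continuous_const (funext fun n => ?_)
    have := hkper.zsmul n 0
    simpa using this
  obtain ⟨c, hc⟩ := QuotientAddGroup.mk_surjective (k 0)
  have hφeq : ∀ y, φ y = (c : UnitAddCircle) + φ₀ y := fun y => by
    have := congrFun hkconst (φ₀ y)
    simp only [hk, φ₀.symm_apply_apply] at this
    rw [← sub_eq_iff_eq_add, this]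
    exact hc.symm
  have hlift : ((translate (Multiplicative.ofAdd c) * h : CircleDeg1Lift) : ℝ → ℝ) =
      fun x => c + h x := by
    ext x; rw [mul_apply, CircleDeg1Lift.translate_apply]
  refine ⟨translate (Multiplicative.ofAdd c) * h, fun x => ?_, ?_, fun x => ?_⟩
  · rw [hφeq, hlift, hφ₀ x, AddCircle.coe_add]
  · rw [hlift]; exact contDiff_const.add hC1
  · rw [hlift, deriv_const_add]; exact hd x

end Conjugacy

/-! ### Series and integrals of the modulus of continuity -/

section Series

/-- The intervals (l^(k+1), l^k) are disjoint and have length (1 − l) l^k. -/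
lemma summable_of_le_integrableOn {l : ℝ} (hl : 0 < l) (hl1 : l < 1) {g : ℝ → ℝ} {c : ℕ → ℝ}
    (hg : IntegrableOn g (Ioo 0 1)) (hc : ∀ k, 0 ≤ c k)
    (hcg : ∀ k, ∀ y ∈ Ioo (l ^ (k + 1)) (l ^ k), c k ≤ g y) :
    Summable fun k => c k * l ^ k := by
  set s : ℕ → Set ℝ := fun k => Ioo (l ^ (k + 1)) (l ^ k) with hs
  have hanti : ∀ {i j : ℕ}, i ≤ j → l ^ j ≤ l ^ i := fun h => pow_le_pow_of_le_one hl.le hl1.le h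
  have hsub : ∀ k, s k ⊆ Ioo 0 1 := fun k y hy =>
    ⟨(pow_pos hl _).trans hy.1, hy.2.trans_le (pow_le_one₀ hl.le hl1.le)⟩
  have hdisj : Pairwise (Function.onFun Disjoint s) := by
    have key : ∀ i j, i < j → Disjoint (s i) (s j) := fun i j hij =>
      Set.disjoint_left.2 fun y hy hy' => by
        have h1 : l ^ j ≤ l ^ (i + 1) := hanti (Nat.succ_le_of_lt hij)
        have h2 : l ^ (i + 1) < y := hy.1
        have h3 : y < l ^ j := hy'.2
        linarith
    intro i j hij
    rcases lt_or_gt_of_ne hij with h | h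
    · exact key i j h
    · exact (key j i h).symm
  have hsum := (hasSum_integral_iUnion (μ := volume) (f := g) (fun k => measurableSet_Ioo) hdisj
    (hg.mono_set (iUnion_subset hsub))).summable
  have hle : ∀ k, c k * l ^ k * (1 - l) ≤ ∫ y in s k, g y := fun k => by
    have h1 : l ^ (k + 1) ≤ l ^ k := hanti (Nat.le_succ k)
    have h2 : ∫ _ in s k, c k = c k * l ^ k * (1 - l) := by
      rw [setIntegral_const, hs, Real.volume_real_Ioo_of_le h1, smul_eq_mul, pow_succ]; ring
    rw [← h2]
    exact setIntegral_mono_on (by simp [hs]) (hg.mono_set (hsub k)) measurableSet_Ioo (hcg k)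
  have h3 : Summable fun k => c k * l ^ k * (1 - l) :=
    hsum.of_nonneg_of_le (fun k => mul_nonneg (mul_nonneg (hc k) (pow_nonneg hl.le k))
      (by linarith)) hle
  exact (summable_mul_right_iff (by linarith)).1 h3

variable {ϖ : ℝ → ℝ}

lemma IsModulus.le_mul (h : IsModulus ϖ) {t x : ℝ} (ht : 0 < t) (hx : 0 < x) :
    ϖ x ≤ ((⌊t⁻¹⌋ : ℝ) + 1) * ϖ (t * x) := by
  have := h.real_mul t⁻¹ (t * x) (inv_pos.2 ht) (mul_pos ht hx)
  rwa [inv_mul_cancel_left₀ ht.ne'] at this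

lemma IsModulus.summable_rpow_mul (h : IsModulus ϖ) {l ν : ℝ} (hl : 0 < l) (hl1 : l < 1)
    (hν : 0 ≤ ν) (hg : IntegrableOn (fun y : ℝ => (-Real.log y) ^ ν * ϖ y / y) (Ioo 0 1)) :
    Summable fun k : ℕ => ((k : ℝ) + 1) ^ ν * ϖ (l ^ k) := by
  have hlog : 0 < -Real.log l := neg_pos.2 (Real.log_neg hl hl1)
  have hs := summable_of_le_integrableOn hl hl1
    (c := fun k => (k * -Real.log l) ^ ν * ϖ (l ^ (k + 1)) / l ^ k) hg
    (fun k => div_nonneg (mul_nonneg (Real.rpow_nonneg (by positivity) _)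
      (h.pos (pow_pos hl _)).le) (pow_pos hl _).le) (fun k y hy => by
      have hy0 : 0 < y := (pow_pos hl _).trans hy.1
      have h1 : ϖ (l ^ (k + 1)) ≤ ϖ y := h.mono (pow_pos hl _) hy.1.le
      have h2 : k * -Real.log l ≤ -Real.log y := by
        have := Real.log_le_log hy0 hy.2.le
        rw [Real.log_pow] at this; linarith
      have h3 := (h.pos (pow_pos hl (k + 1))).le
      have h4 : 0 ≤ k * -Real.log l := by positivity
      have h5 := hy.2.le
      have h6 := Real.rpow_nonneg h4 ν
      have h7 : 0 ≤ (-Real.log y) ^ ν := Real.rpow_nonneg (h4.trans h2) ν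
      have h8 := mul_nonneg h7 (h.pos hy0).le
      gcongr)
  have hs1 := (summable_nat_add_iff 1).2 hs
  have hlogν : 0 < (-Real.log l) ^ ν := Real.rpow_pos_of_pos hlog _
  have hs2 := hs1.mul_left (((⌊(l ^ 2)⁻¹⌋ : ℝ) + 1) * ((-Real.log l) ^ ν)⁻¹)
  refine hs2.of_nonneg_of_le (fun k => mul_nonneg (Real.rpow_nonneg (by positivity) _)
    (h.pos (pow_pos hl _)).le) fun k => ?_
  -- Two powers of l are lost: one because ϖ is bounded below at the left end of each interval, one
  -- by the index shift that turns k^ν into (k + 1)^ν.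
  have h1 := h.le_mul (pow_pos hl 2) (pow_pos hl k)
  rw [← pow_add] at h1
  have h2 : 0 ≤ ((k : ℝ) + 1) ^ ν := Real.rpow_nonneg (by positivity) _
  calc ((k : ℝ) + 1) ^ ν * ϖ (l ^ k)
      ≤ ((k : ℝ) + 1) ^ ν * (((⌊(l ^ 2)⁻¹⌋ : ℝ) + 1) * ϖ (l ^ (2 + k))) := by gcongr
    _ = _ := by
      have h3 : (0 : ℝ) < l ^ (k + 1) := pow_pos hl _
      rw [Nat.cast_add_one, Real.mul_rpow (by positivity) hlog.le,
        show k + 1 + 1 = 2 + k by ring]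
      field_simp

lemma IsModulus.summable_pow_mul (h : IsModulus ϖ) {l a b : ℝ} (hl : 0 < l) (hl1 : l < 1)
    (ha : a = l ^ (-b)) (hb : 0 ≤ b)
    (hg : IntegrableOn (fun y : ℝ => ϖ y / y ^ (1 + b)) (Ioo 0 1)) :
    Summable fun k : ℕ => a ^ k * ϖ (l ^ k) := by
  have hs := summable_of_le_integrableOn hl hl1
    (c := fun k => ϖ (l ^ (k + 1)) / (l ^ k) ^ (1 + b)) hg
    (fun k => div_nonneg (h.pos (pow_pos hl _)).le (Real.rpow_nonneg (pow_pos hl _).le _))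
    (fun k y hy => by
      have hy0 : 0 < y := (pow_pos hl _).trans hy.1
      have h1 : ϖ (l ^ (k + 1)) ≤ ϖ y := h.mono (pow_pos hl _) hy.1.le
      have h3 := (h.pos hy0).le
      have h4 : 0 < y ^ (1 + b) := Real.rpow_pos_of_pos hy0 _
      have h5 : y ^ (1 + b) ≤ (l ^ k) ^ (1 + b) :=
        Real.rpow_le_rpow hy0.le hy.2.le (by linarith)
      gcongr)
  refine (hs.mul_left ((⌊l⁻¹⌋ : ℝ) + 1)).of_nonneg_of_le (fun k => ?_) fun k => ?_
  · have := (h.pos (pow_pos hl k)).le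
    rw [ha]; positivity
  have h1 := h.le_mul hl (pow_pos hl k)
  rw [← pow_succ'] at h1
  have h2 : 0 < l ^ k := pow_pos hl k
  have h3 : a ^ k = ((l ^ k) ^ b)⁻¹ := by
    rw [ha, ← Real.rpow_natCast, ← Real.rpow_mul hl.le, ← Real.rpow_natCast l k,
      ← Real.rpow_mul hl.le, ← Real.rpow_neg hl.le]
    congr 1; ring
  have h4 : 0 < (l ^ k) ^ b := Real.rpow_pos_of_pos h2 _
  rw [h3, Real.rpow_add h2, Real.rpow_one]
  calc ((l ^ k) ^ b)⁻¹ * ϖ (l ^ k)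
      ≤ ((l ^ k) ^ b)⁻¹ * (((⌊l⁻¹⌋ : ℝ) + 1) * ϖ (l ^ (k + 1))) := by gcongr
    _ = _ := by field_simp

lemma summable_rpow_mul_pow {l : ℝ} (hl : 0 < l) (hl1 : l < 1) (ν : ℝ) :
    Summable fun i : ℕ => ((i : ℝ) + 1) ^ ν * l ^ i := by
  obtain ⟨N, hN⟩ := exists_nat_ge ν
  have h := summable_pow_mul_geometric_of_norm_lt_one (R := ℝ) N (r := l)
    (by rwa [Real.norm_eq_abs, abs_of_pos hl])
  have h1 := ((summable_nat_add_iff 1).2 h).mul_left l⁻¹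
  refine h1.of_nonneg_of_le (fun i => by positivity) fun i => ?_
  have h2 : ((i : ℝ) + 1) ^ ν ≤ ((i : ℝ) + 1) ^ N := by
    rw [← Real.rpow_natCast]
    exact Real.rpow_le_rpow_of_exponent_le (by linarith [Nat.cast_nonneg (α := ℝ) i]) hN
  calc _ ≤ ((i : ℝ) + 1) ^ N * l ^ i := by gcongr
    _ = _ := by push_cast; rw [pow_succ]; field_simp

end Series

/-! ### Convergence of the integrals for concrete moduli -/

section Examples

variable {ϖ : ℝ → ℝ}

lemma integrableOn_of_isBigO {g h : ℝ → ℝ} (hg : ContinuousOn g (Ioc 0 1))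
    (hO : g =O[𝓝[>] 0] h) (hh : IntegrableAtFilter h (𝓝[>] 0)) : IntegrableOn g (Ioo 0 1) := by
  have h1 : IntegrableAtFilter g (𝓝[>] 0) := hO.integrableAtFilter
    ⟨Ioc 0 1, Ioc_mem_nhdsGT one_pos, hg.aestronglyMeasurable measurableSet_Ioc⟩ hh
  obtain ⟨s, hs, hgs⟩ := h1
  obtain ⟨r, hr, hrs⟩ := mem_nhdsGT_iff_exists_Ioc_subset.1 hs
  have h2 : IntegrableOn g (Icc r 1) :=
    (hg.mono fun x hx => ⟨(mem_Ioi.1 hr).trans_le hx.1, hx.2⟩).integrableOn_compact isCompact_Icc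
  refine ((hgs.mono_set hrs).union h2).mono_set fun x hx => ?_
  rcases le_total x r with h | h
  · exact Or.inl ⟨hx.1, h⟩
  · exact Or.inr ⟨h, hx.2.le⟩

lemma integrableAtFilter_rpow {s : ℝ} (hs : -1 < s) :
    IntegrableAtFilter (fun x : ℝ => x ^ s) (𝓝[>] 0) :=
  ⟨Ioc 0 1, Ioc_mem_nhdsGT one_pos,
    (intervalIntegrable_iff_integrableOn_Ioc_of_le zero_le_one).1
      (intervalIntegral.intervalIntegrable_rpow' hs)⟩

lemma tendsto_iterate_log (i : ℕ) :
    Tendsto (fun x : ℝ => Real.log^[i] x⁻¹) (𝓝[>] 0) atTop := by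
  induction i with
  | zero => exact tendsto_inv_nhdsGT_zero
  | succ i ih =>
    simp only [Function.iterate_succ_apply']
    exact Real.tendsto_log_atTop.comp ih

lemma hasDerivAt_iterate_log (n : ℕ) {x : ℝ} (hx : 0 < x)
    (hpos : ∀ i ≤ n, 0 < Real.log^[i] x⁻¹) :
    HasDerivAt (fun x : ℝ => Real.log^[n + 1] x⁻¹)
      (-(x * ∏ i ∈ Finset.Ico 1 (n + 1), Real.log^[i] x⁻¹)⁻¹) x := by
  induction n with
  | zero =>
    have := (hasDerivAt_inv hx.ne').log (inv_pos.2 hx).ne'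
    simp only [zero_add, Function.iterate_one, Finset.Ico_self, Finset.prod_empty, mul_one]
    refine this.congr_deriv ?_
    field_simp
  | succ n ih =>
    have h1 := (ih fun i hi => hpos i (by omega)).log (hpos (n + 1) le_rfl).ne'
    have e : (fun x : ℝ => Real.log^[n + 1 + 1] x⁻¹) =
        fun x => Real.log (Real.log^[n + 1] x⁻¹) := by
      ext x; rw [Function.iterate_succ_apply']
    rw [e]
    refine h1.congr_deriv ?_
    rw [Finset.prod_Ico_succ_top (show 1 ≤ n + 1 by omega), ← mul_assoc, mul_inv _ (Real.log^[n + 1] _), neg_div,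
      div_eq_mul_inv]

/-- The integrand is the nonnegative derivative of L_{n+1}^(−σ)/σ, which tends to 0 at 0⁺. -/
lemma integrableAtFilter_iterate_log {n : ℕ} {σ : ℝ} (hσ : 0 < σ) :
    IntegrableAtFilter (fun x : ℝ => 1 / (x * (∏ i ∈ Finset.Ico 1 (n + 1), Real.log^[i] x⁻¹) *
      (Real.log^[n + 1] x⁻¹) ^ (1 + σ))) (𝓝[>] 0) := by
  have hev : ∀ᶠ x : ℝ in 𝓝[>] 0, ∀ i ∈ Finset.range (n + 2), 0 < Real.log^[i] x⁻¹ :=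
    (Filter.eventually_all_finset _).2 fun i _ => (tendsto_iterate_log i).eventually_gt_atTop 0
  obtain ⟨r, hr, hrs⟩ := mem_nhdsGT_iff_exists_Ioc_subset.1 hev
  have hr0 : (0 : ℝ) < r := hr
  have hpos : ∀ x ∈ Ioc 0 r, ∀ i ≤ n + 1, 0 < Real.log^[i] x⁻¹ := fun x hx i hi =>
    hrs hx i (Finset.mem_range.2 (by omega))
  refine ⟨Ioc 0 r, Ioc_mem_nhdsGT hr0, ?_⟩
  have hd : ∀ x ∈ Ioc 0 r, HasDerivAt (fun x : ℝ => (Real.log^[n + 1] x⁻¹) ^ (-σ) / σ)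
      (1 / (x * (∏ i ∈ Finset.Ico 1 (n + 1), Real.log^[i] x⁻¹) *
        (Real.log^[n + 1] x⁻¹) ^ (1 + σ))) x := by
    intro x hx
    have hL := hpos x hx (n + 1) le_rfl
    have h1 := ((hasDerivAt_iterate_log n hx.1 fun i hi => hpos x hx i (by omega)).rpow_const
      (p := -σ) (Or.inl hL.ne')).div_const σ
    refine h1.congr_deriv ?_
    rw [show -σ - 1 = -(1 + σ) by ring, Real.rpow_neg hL.le]
    have h2 := Real.rpow_pos_of_pos hL (1 + σ)
    have h3 : 0 < ∏ i ∈ Finset.Ico 1 (n + 1), Real.log^[i] x⁻¹ :=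
      Finset.prod_pos fun i hi => hpos x hx i (by have := Finset.mem_Ico.1 hi; omega)
    have h4 := hx.1.ne'
    field_simp
  refine intervalIntegral.integrableOn_deriv_of_nonneg
    (g := fun x : ℝ => (Real.log^[n + 1] x⁻¹) ^ (-σ) / σ) ?_
    (fun x hx => hd x ⟨hx.1, hx.2.le⟩) fun x hx => ?_
  · intro x hx
    rcases eq_or_lt_of_le hx.1 with h | h
    · subst h
      -- The default values of inverse, logarithm and power make the primitive equal to 0 at 0,
      -- which is also its limit, so it is continuous up to the endpoint.
      have h0 : Real.log^[n + 1] (0 : ℝ)⁻¹ = 0 := by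
        rw [inv_zero]; exact Function.iterate_fixed Real.log_zero _
      have ht : Tendsto (fun x : ℝ => (Real.log^[n + 1] x⁻¹) ^ (-σ) / σ) (𝓝[>] 0) (𝓝 0) := by
        have := ((tendsto_rpow_neg_atTop hσ).comp (tendsto_iterate_log (n + 1))).div_const σ
        simpa using this
      rw [← continuousWithinAt_sdiff_self, ContinuousWithinAt, h0,
        Real.zero_rpow (neg_ne_zero.2 hσ.ne'), zero_div]
      exact ht.mono_left (nhdsWithin_mono _ fun y hy =>
        lt_of_le_of_ne hy.1.1 fun h => hy.2 h.symm)
    · exact (hd x ⟨h, hx.2⟩).continuousAt.continuousWithinAt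
  · have hx' : x ∈ Ioc 0 r := ⟨hx.1, hx.2.le⟩
    have h3 : 0 < ∏ i ∈ Finset.Ico 1 (n + 1), Real.log^[i] x⁻¹ :=
      Finset.prod_pos fun i hi => hpos x hx' i (by have := Finset.mem_Ico.1 hi; omega)
    have h2 := Real.rpow_pos_of_pos (hpos x hx' (n + 1) le_rfl) (1 + σ)
    have := hx.1
    positivity

lemma continuousOn_log_rpow_mul (h : IsModulus ϖ) {ν : ℝ} (hν : 0 ≤ ν) :
    ContinuousOn (fun y : ℝ => (-Real.log y) ^ ν * ϖ y / y) (Ioc 0 1) := by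
  have h0 : ∀ y ∈ Ioc (0 : ℝ) 1, y ≠ 0 := fun y hy => hy.1.ne'
  refine ContinuousOn.div (ContinuousOn.mul ?_ (h.continuous.mono fun y hy => hy.1))
    continuousOn_id h0
  exact (Real.continuousOn_log.mono h0).neg.rpow_const fun y _ => Or.inr hν

lemma isBigO_log_rpow_mul {f : ℝ → ℝ} (hf : ϖ =Θ[𝓝[>] (0 : ℝ)] f) (ν : ℝ) :
    (fun y : ℝ => (-Real.log y) ^ ν * ϖ y / y) =O[𝓝[>] 0]
      fun y => (-Real.log y) ^ ν * f y / y := by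
  simp only [div_eq_mul_inv]
  exact ((isBigO_refl _ _).mul hf.1).mul (isBigO_refl _ _)

lemma eventually_mem_Ioo : ∀ᶠ y : ℝ in 𝓝[>] 0, y ∈ Ioo (0 : ℝ) 1 := Ioo_mem_nhdsGT one_pos

/-- Half of the exponent α absorbs the power of the logarithm; the other half keeps the integrand
integrable. -/
lemma IsHolderType.integrableOn_log (h : IsModulus ϖ) {α ν : ℝ} (hν : 0 ≤ ν) (hα : 0 < α)
    (hH : IsHolderType α ϖ) :
    IntegrableOn (fun y : ℝ => (-Real.log y) ^ ν * ϖ y / y) (Ioo 0 1) := by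
  refine integrableOn_of_isBigO (continuousOn_log_rpow_mul h hν)
    ((isBigO_log_rpow_mul hH ν).trans ?_)
    (integrableAtFilter_rpow (s := α / 2 - 1) (by linarith))
  have h1 := (isLittleO_abs_log_rpow_rpow_nhdsGT_zero ν (s := -(α / 2)) (by linarith)).isBigO
  have h2 := h1.mul (isBigO_refl (fun y : ℝ => y ^ (α - 1)) (𝓝[>] 0))
  refine h2.congr' ?_ ?_
  · filter_upwards [eventually_mem_Ioo] with y hy
    rw [abs_of_neg (Real.log_neg hy.1 hy.2), Real.rpow_sub_one hy.1.ne']; ring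
  · filter_upwards [eventually_mem_Ioo] with y hy
    rw [← Real.rpow_add hy.1]; congr 1; ring

lemma IsLipschitzType.isHolderType (hH : IsLipschitzType ϖ) : IsHolderType 1 ϖ := by
  simpa only [IsHolderType, Real.rpow_one] using! hH

lemma IsIterLogType.integrableOn_log (h : IsModulus ϖ) {ν σ : ℝ} {l : ℕ} (hν : 0 ≤ ν)
    (hl : 1 ≤ l) (hσ : 0 < σ) (hH : IsIterLogType ν l σ ϖ) :
    IntegrableOn (fun y : ℝ => (-Real.log y) ^ ν * ϖ y / y) (Ioo 0 1) := by
  obtain ⟨n, rfl⟩ := Nat.exists_eq_add_of_le' hl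
  refine integrableOn_of_isBigO (continuousOn_log_rpow_mul h hν)
    ((isBigO_log_rpow_mul hH ν).congr' .rfl ?_) (integrableAtFilter_iterate_log (n := n) hσ)
  filter_upwards [eventually_mem_Ioo] with y hy
  have h1 : 0 < -Real.log y := neg_pos.2 (Real.log_neg hy.1 hy.2)
  have h2 := (Real.rpow_pos_of_pos h1 ν).ne'
  have h3 : (-Real.log y) ^ ν * ((-Real.log y) ^ ν)⁻¹ = 1 := mul_inv_cancel₀ h2
  rw [Real.log_inv]
  simp only [mul_inv, div_eq_mul_inv]
  linear_combination (∏ i ∈ Finset.Ico 1 (n + 1), Real.log^[i] y⁻¹)⁻¹ *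
    ((Real.log^[n + 1] y⁻¹) ^ (1 + σ))⁻¹ * y⁻¹ * h3

lemma IsLogHolderType.integrableOn_log (h : IsModulus ϖ) {ν α : ℝ} (hν : 0 ≤ ν)
    (hα : ν + 1 < α) (hH : IsLogHolderType α ϖ) :
    IntegrableOn (fun y : ℝ => (-Real.log y) ^ ν * ϖ y / y) (Ioo 0 1) := by
  refine integrableOn_of_isBigO (continuousOn_log_rpow_mul h hν)
    ((isBigO_log_rpow_mul hH ν).congr' .rfl ?_)
    -- The integrand is comparable to 1/(y L₁^(α−ν)), the case without intermediate logarithms, with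
    -- α − ν = 1 + σ.
    (integrableAtFilter_iterate_log (n := 0) (σ := α - ν - 1) (by linarith))
  filter_upwards [eventually_mem_Ioo] with y hy
  have h1 : 0 < -Real.log y := neg_pos.2 (Real.log_neg hy.1 hy.2)
  simp only [zero_add, Function.iterate_one, Finset.Ico_self, Finset.prod_empty, mul_one,
    Real.log_inv]
  rw [← Real.rpow_add h1, show 1 + (α - ν - 1) = -(ν + -α) by ring, Real.rpow_neg h1.le]
  have := (Real.rpow_pos_of_pos h1 (ν + -α)).ne'
  have := hy.1.ne'
  field_simp

lemma IsHolderType.integrableOn_rpow (h : IsModulus ϖ) {α b : ℝ} (hα : b < α)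
    (hH : IsHolderType α ϖ) :
    IntegrableOn (fun y : ℝ => ϖ y / y ^ (1 + b)) (Ioo 0 1) := by
  refine integrableOn_of_isBigO ?_ (h := fun y => y ^ (α - (1 + b))) ?_
    (integrableAtFilter_rpow (by linarith))
  · refine ContinuousOn.div (h.continuous.mono fun y hy => hy.1)
      (continuousOn_id.rpow_const fun y hy => Or.inl hy.1.ne') fun y hy =>
        (Real.rpow_pos_of_pos hy.1 _).ne'
  · have h1 := hH.1.mul (isBigO_refl (fun y : ℝ => (y ^ (1 + b))⁻¹) (𝓝[>] 0))
    refine h1.congr' (.of_forall fun y => (div_eq_mul_inv _ _).symm) ?_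
    filter_upwards [eventually_mem_Ioo] with y hy
    rw [Real.rpow_sub hy.1, div_eq_mul_inv]

end Examples

/-! ### The conjugacy -/

section Main

open CircleDeg1Lift

variable {ϖ : ℝ → ℝ} {F : CircleDeg1Lift} {T : UnitAddCircle ≃ₜ UnitAddCircle}

/-- The conjugacy is `C¹` if the modulus is summable along the geometric sequence of ratio
`denjoyLambda F`, with weights that dominate the partial quotients. -/
theorem admitsC1Conjugacy_of_summable (hϖ : IsModulus ϖ) (hF : IsLift F T)
    (hT : IsC2ModulusDiffeoLift ϖ F) (hρ : Irrational (rotationNumber F)) {A W : ℕ → ℝ}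
    (hA : ∀ k, 0 ≤ A k) (hAW : ∀ i j, A (i + j) ≤ A i * W j)
    (hWs : Summable fun i => W i * denjoyLambda F ^ i)
    (hK : partialQuotientSucc (rotationNumber F) =O[atTop] A)
    (hs : Summable fun k => A k * ϖ (denjoyLambda F ^ k)) :
    AdmitsC1Conjugacy T (rotationNumber F) := by
  have hτ : Irrational (translationNumber F) := irrational_sub_intCast_iff.1 hρ
  have hl := denjoyLambda_pos F
  obtain ⟨C, hC, h⟩ := hT.exists_abs_retLog_le hϖ hτ
  have he0 : ∀ k, 0 ≤ ϖ (denjoyLambda F ^ k) := fun k => (hϖ.pos (pow_pos hl k)).le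
  have hs1 := summable_mul_geomConv hl.le he0 hA hAW hWs hs
  have hs2 := summable_mul_geomConv hl.le (geomConv_nonneg hl.le he0) hA hAW hWs hs1
  set y := geomConv (denjoyLambda F)
    (geomConv (denjoyLambda F) fun k => ϖ (denjoyLambda F ^ k)) with hy
  -- Level 0 is a translation and has zero log derivative. The shift pairs the partial quotient
  -- k_{m+1} with y m.
  set Y : ℕ → ℝ := fun m => Nat.casesOn m 0 fun n => C * y n with hY
  have hYb : ∀ m x, |retLog F m x| ≤ Y m := fun m x => by
    cases m with
    | zero => simp [retLog_zero, hY]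
    | succ m => exact h m x
  have hsum : Summable fun m => quot (translationNumber F) m * Y (m + 1) := by
    refine summable_of_isBigO_nat (hs2.mul_left C) ?_
    have h1 := hK.mul (isBigO_refl (fun m => Y (m + 1)) atTop)
    refine h1.congr (fun m => ?_) fun m => ?_
    · rw [rotationNumber, partialQuotientSucc_eq_quot hτ]
    · simp only [hY]; ring
  obtain ⟨u, hu, hpos, hper, hinv⟩ := hT.exists_invariant_density hτ hYb hsum
  exact hT.admitsC1Conjugacy_of_density hF hρ hu hpos hper hinv

theorem admitsC1Conjugacy_of_polynomial (hϖ : IsModulus ϖ) (hF : IsLift F T)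
    (hT : IsC2ModulusDiffeoLift ϖ F) (hρ : Irrational (rotationNumber F)) {ν : ℝ} (hν : 0 ≤ ν)
    (hK : partialQuotientSucc (rotationNumber F) =O[atTop] fun n : ℕ => (n : ℝ) ^ ν)
    (hg : IntegrableOn (fun y : ℝ => (-Real.log y) ^ ν * ϖ y / y) (Ioo 0 1)) :
    AdmitsC1Conjugacy T (rotationNumber F) := by
  have hl := denjoyLambda_pos F
  have hl1 := denjoyLambda_lt_one F
  -- Using n + 1 instead of n makes the weight submultiplicative, since i + j + 1 ≤ (i + 1)(j + 1).
  refine admitsC1Conjugacy_of_summable hϖ hF hT hρ (A := fun n => ((n : ℝ) + 1) ^ ν)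
    (W := fun n => ((n : ℝ) + 1) ^ ν) (fun k => Real.rpow_nonneg (by positivity) _)
    (fun i j => ?_) (summable_rpow_mul_pow hl hl1 ν) (hK.trans ?_)
    (hϖ.summable_rpow_mul hl hl1 hν hg)
  · rw [← Real.mul_rpow (by positivity) (by positivity)]
    refine Real.rpow_le_rpow (by positivity) ?_ hν
    push_cast
    nlinarith [mul_nonneg (Nat.cast_nonneg (α := ℝ) i) (Nat.cast_nonneg (α := ℝ) j)]
  · refine IsBigO.of_bound 1 (.of_forall fun n => ?_)
    rw [one_mul, Real.norm_of_nonneg (Real.rpow_nonneg (by positivity) _),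
      Real.norm_of_nonneg (Real.rpow_nonneg (by positivity) _)]
    exact Real.rpow_le_rpow (by positivity) (by linarith) hν

theorem admitsC1Conjugacy_of_exponential (hϖ : IsModulus ϖ) (hF : IsLift F T)
    (hT : IsC2ModulusDiffeoLift ϖ F) (hρ : Irrational (rotationNumber F)) {a b : ℝ}
    (hal : a * denjoyLambda F < 1) (ha : a = denjoyLambda F ^ (-b)) (hb : 0 ≤ b)
    (hK : partialQuotientSucc (rotationNumber F) =O[atTop] fun n : ℕ => a ^ n)
    (hg : IntegrableOn (fun y : ℝ => ϖ y / y ^ (1 + b)) (Ioo 0 1)) :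
    AdmitsC1Conjugacy T (rotationNumber F) := by
  have hl := denjoyLambda_pos F
  have hapos : 0 < a := by rw [ha]; positivity
  refine admitsC1Conjugacy_of_summable hϖ hF hT hρ (A := fun n => a ^ n)
    (W := fun n => a ^ n) (fun k => by positivity) (fun i j => (pow_add a i j).le) ?_ hK
    (hϖ.summable_pow_mul hl (denjoyLambda_lt_one F) ha hb hg)
  simp only [← mul_pow]
  exact summable_geometric_of_lt_one (by positivity) hal

end Main

end CircleConj

theorem corollary4p4
    (ϖ : ℝ → ℝ) (hϖ : CircleConj.IsModulus ϖ)
    (T : UnitAddCircle ≃ₜ UnitAddCircle) (F : CircleDeg1Lift)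
    (hF : CircleConj.IsLift F T) (hT : CircleConj.IsC2ModulusDiffeoLift ϖ F)
    (hρ : Irrational (CircleConj.rotationNumber F)) :
    -- constant type
    (((CircleConj.partialQuotientSucc (CircleConj.rotationNumber F)) =O[atTop]
          (fun _ : ℕ => (1 : ℝ)) →
        IntegrableOn (fun y : ℝ => ϖ y / y) (Ioo 0 1) →
        CircleConj.AdmitsC1Conjugacy T (CircleConj.rotationNumber F)) ∧
      ((CircleConj.IsLipschitzType ϖ ∨
          (∃ α : ℝ, 0 < α ∧ α < 1 ∧ CircleConj.IsHolderType α ϖ) ∨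
          (∃ α : ℝ, 1 < α ∧ CircleConj.IsLogHolderType α ϖ) ∨
          (∃ (l : ℕ) (σ : ℝ), 1 ≤ l ∧ 0 < σ ∧ CircleConj.IsIterLogType 0 l σ ϖ)) →
        IntegrableOn (fun y : ℝ => ϖ y / y) (Ioo 0 1))) ∧
    -- polynomial type
    (∀ ν : ℝ, 0 < ν →
      ((CircleConj.partialQuotientSucc (CircleConj.rotationNumber F)) =O[atTop]
          (fun n : ℕ => (n : ℝ) ^ ν) →
        IntegrableOn (fun y : ℝ => (-Real.log y) ^ ν * ϖ y / y) (Ioo 0 1) →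
        CircleConj.AdmitsC1Conjugacy T (CircleConj.rotationNumber F)) ∧
      ((CircleConj.IsLipschitzType ϖ ∨
          (∃ α : ℝ, 0 < α ∧ α < 1 ∧ CircleConj.IsHolderType α ϖ) ∨
          (∃ α : ℝ, ν + 1 < α ∧ CircleConj.IsLogHolderType α ϖ) ∨
          (∃ (l : ℕ) (σ : ℝ), 1 ≤ l ∧ 0 < σ ∧ CircleConj.IsIterLogType ν l σ ϖ)) →
        IntegrableOn (fun y : ℝ => (-Real.log y) ^ ν * ϖ y / y) (Ioo 0 1))) ∧
    -- exponential type, where `a = λ ^ (-b)`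
    (∀ a b : ℝ, 1 < a → a < (CircleConj.denjoyLambda F)⁻¹ →
      b = Real.log a / Real.log (CircleConj.denjoyLambda F)⁻¹ →
      ((CircleConj.partialQuotientSucc (CircleConj.rotationNumber F)) =O[atTop]
          (fun n : ℕ => a ^ n) →
        IntegrableOn (fun y : ℝ => ϖ y / y ^ (1 + b)) (Ioo 0 1) →
        CircleConj.AdmitsC1Conjugacy T (CircleConj.rotationNumber F)) ∧
      ((CircleConj.IsLipschitzType ϖ ∨
          (∃ α : ℝ, b < α ∧ α < 1 ∧ CircleConj.IsHolderType α ϖ)) →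
        IntegrableOn (fun y : ℝ => ϖ y / y ^ (1 + b)) (Ioo 0 1))) := by
  have examples : ∀ ν : ℝ, 0 ≤ ν →
      (CircleConj.IsLipschitzType ϖ ∨
          (∃ α : ℝ, 0 < α ∧ α < 1 ∧ CircleConj.IsHolderType α ϖ) ∨
          (∃ α : ℝ, ν + 1 < α ∧ CircleConj.IsLogHolderType α ϖ) ∨
          (∃ (l : ℕ) (σ : ℝ), 1 ≤ l ∧ 0 < σ ∧ CircleConj.IsIterLogType ν l σ ϖ)) →
        IntegrableOn (fun y : ℝ => (-Real.log y) ^ ν * ϖ y / y) (Ioo 0 1) := by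
    rintro ν hν (h | ⟨α, hα, -, h⟩ | ⟨α, hα, h⟩ | ⟨l, σ, hl, hσ, h⟩)
    · exact h.isHolderType.integrableOn_log hϖ hν one_pos
    · exact h.integrableOn_log hϖ hν hα
    · exact h.integrableOn_log hϖ hν hα
    · exact h.integrableOn_log hϖ hν hl hσ
  refine ⟨⟨fun hK hg => ?_, fun h => ?_⟩, fun ν hν => ⟨fun hK hg => ?_, examples ν hν.le⟩,
    fun a b ha hal hb => ?_⟩
  -- Constant type is the polynomial type with ν = 0, where the powers reduce to 1.
  · refine CircleConj.admitsC1Conjugacy_of_polynomial hϖ hF hT hρ le_rfl ?_ ?_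
    · simpa only [Real.rpow_zero] using hK
    · simpa only [Real.rpow_zero, one_mul] using hg
  · have := examples 0 le_rfl (by simpa only [zero_add] using h)
    simpa only [Real.rpow_zero, one_mul] using this
  · exact CircleConj.admitsC1Conjugacy_of_polynomial hϖ hF hT hρ hν.le hK hg
  · have hl := CircleConj.denjoyLambda_pos F
    have hlog : 0 < Real.log (CircleConj.denjoyLambda F)⁻¹ :=
      Real.log_pos ((one_lt_inv₀ hl).2 (CircleConj.denjoyLambda_lt_one F))
    have hb0 : 0 ≤ b := by rw [hb]; exact div_nonneg (Real.log_nonneg ha.le) hlog.le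
    -- This strict inequality lets the Lipschitz case be treated as the Hölder case with exponent 1.
    have hb1 : b < 1 := by
      rw [hb, div_lt_one hlog]; exact Real.log_lt_log (by linarith) hal
    have hab : a = CircleConj.denjoyLambda F ^ (-b) := by
      rw [Real.rpow_def_of_pos hl, mul_neg, ← neg_mul, ← Real.log_inv, hb,
        mul_div_cancel₀ _ hlog.ne', Real.exp_log (by linarith)]
    refine ⟨fun hK hg => CircleConj.admitsC1Conjugacy_of_exponential hϖ hF hT hρ
      ((lt_inv_mul_iff₀ hl).1 (by simpa using hal) |>.trans_eq' (mul_comm _ _)) hab hb0 hK hg, ?_⟩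
    rintro (h | ⟨α, hα, -, h⟩)
    · exact h.isHolderType.integrableOn_rpow hϖ hb1
    · exact h.integrableOn_rpow hϖ hα
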